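/- Let $p\ge 1$ be an integer. Consider the Bogoyavlensky lattice $$u_j'=u_j\,(u_{j+1}+\cdots+u_{j+p}-u_{j-1}-\cdots-u_{j-p}),\qquad j\in\mathbb Z,$$ for real-valued functions $u_j=u_j(t)$, $'=d/dt$, with the unit-step initial data $u_j(0)=0$ for $j\le 0$ and $u_j(0)=1$ for $j>0$. This Cauchy problem has a solution defined for all $t\in\mathbb R$, and on every interval $I\ni 0$ any solution coincides with it. The solution satisfies $u_j\equiv 0$ for $j\le 0$, and $$u_1=\frac{f_1'}{f_1},\qquad u_j=\frac{f_j'}{f_j}-\frac{f_{j-1}'}{f_{j-1}}\quad(j\ge 2),$$ where the functions $f_j$ are differentiable and nowhere zero on $\mathbb R$; for $j=1,\dots,p+1$ they are the generalized hypergeometric functions $$f_j(t)={}_pF_p\Bigl(\tfrac{j}{p+1},\dots,\widehat{1},\dots,\tfrac{j+p}{p+1};\ \tfrac{j+1}{p},\dots,\tfrac{j+p}{p};\ \tfrac{(p+1)^{p+1}}{p^p}\,t\Bigr)$$ ($\widehat 1$ means that the parameter $\frac{p+1}{p+1}=1$ is omitted), and the $f_j$ with $j>p+1$ are determined from these by the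 bilinear equations $$f_{j-1}f_j'-f_{j-1}'f_j=f_{j-p-1}f_{j+p}\quad(j\ge 1),\qquad f_j=1\ \text{ for } j\le 0.$$ Here ${}_pF_p(a_1,\dots,a_p;b_1,\dots,b_p;z)=\sum_{n\ge0}\frac{(a_1)_n\cdots(a_p)_n}{(b_1)_n\cdots(b_p)_n}\frac{z^n}{n!}$ with $(a)_n=a(a+1)\cdots(a+n-1)$, $(a)_0=1$; for the parameters above the series converges for all real $z$. -/

import Mathlib

noncomputable section

/-- The `n`-th term `(a₁)ₙ ⋯ (a_r)ₙ / ((b₁)ₙ ⋯ (b_s)ₙ) * zⁿ / n!` of the generalized hypergeometric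
series with upper parameters `a` and lower parameters `b`; `(x)ₙ = x (x + 1) ⋯ (x + n - 1)`. -/
def hypTerm (a b : Multiset ℝ) (z : ℝ) (n : ℕ) : ℝ :=
  (a.map fun x => (ascPochhammer ℝ n).eval x).prod /
    (b.map fun x => (ascPochhammer ℝ n).eval x).prod * (z ^ n / (n.factorial : ℝ))

/-- The generalized hypergeometric function, as the sum of its series. -/
def hypF (a b : Multiset ℝ) (z : ℝ) : ℝ := ∑' n, hypTerm a b z n

/-- The parameters `j/(p+1), …, (j+p)/(p+1)` with `(p+1)/(p+1) = 1` omitted. -/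
def stepUpper (p j : ℕ) : Multiset ℝ :=
  ((Finset.Icc j (j + p)).erase (p + 1)).val.map fun m => (m : ℝ) / ((p : ℝ) + 1)

/-- The parameters `(j+1)/p, …, (j+p)/p`. -/
def stepLower (p j : ℕ) : Multiset ℝ :=
  (Finset.Icc (j + 1) (j + p)).val.map fun m => (m : ℝ) / (p : ℝ)

/-- The scaling factor `(p+1)^(p+1) / p^p` of the argument. -/
def stepScale (p : ℕ) : ℝ := ((p : ℝ) + 1) ^ (p + 1) / (p : ℝ) ^ p

/-- The hypergeometric function `t ↦ ₚFₚ(stepUpper; stepLower; (p+1)^(p+1) t / p^p)`. -/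
def stepTau (p j : ℕ) (t : ℝ) : ℝ :=
  hypF (stepUpper p j) (stepLower p j) (stepScale p * t)

/-- `u` solves on the interval `I` (one-sided derivatives at end points belonging to `I`) the
Bogoyavlensky lattice
`u_j' = u_j (u_{j+1} + ⋯ + u_{j+p} - u_{j-1} - ⋯ - u_{j-p})`, `j ∈ ℤ`. -/
def IsBogoyavlenskySolution (p : ℕ) (I : Set ℝ) (u : ℤ → ℝ → ℝ) : Prop :=
  ∀ j : ℤ, ∀ t ∈ I, HasDerivWithinAt (u j)
    (u j t * ((∑ k ∈ Finset.Icc 1 p, u (j + (k : ℤ)) t) -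
      (∑ k ∈ Finset.Icc 1 p, u (j - (k : ℤ)) t))) I t

/-- The unit-step data: `u_j(0) = 0` for `j ≤ 0` and `u_j(0) = 1` for `j > 0`. -/
def IsUnitStep (u : ℤ → ℝ → ℝ) : Prop :=
  ∀ j : ℤ, u j 0 = if j ≤ 0 then 0 else 1

end

noncomputable section

open Set Filter Topology

/-! ### Scalar linear equations on an interval -/

/-! Write `S j` for `u 1 + ⋯ + u j`. Each site satisfies a scalar linear equation with continuous
coefficient, so zeros stay zero and positive values stay positive on any interval containing `0`.
The Lax operator has a step `+1` and a weighted step `-p`, and the first rows of its powers are the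
path weights. If `0 ≤ k ≤ p` and `F' = F * S (k+1)`, `F 0 = 1`, the Lax equation collapses to `(F *
W n)' = F * W (n+p+1)`, where `W n` is the weight of `n`-step paths ending at `k`
(`hasDerivWithinAt_pathWeight`, `isAbsMonotoneSeq_pathWeight`). Hence all derivatives of `F` are
nonnegative. By Bernstein's theorem `F` is the sum of its Taylor series, whose coefficients are path
weights of the initial data. For the unit step these are ballot numbers, and the series is the
hypergeometric one.

This gives uniqueness without any growth condition: `S 1, …, S (p+1)` are forced by the data, and
the equation for `u m` then yields `S (m+p)` from smaller indices (`prefixSum_eq`).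

For existence the lattice is truncated to `N` sites. The Taylor series bounds the first `p+1` prefix
sums uniformly in `N`. Monotonicity of prefix sums in time and the equation for `log (u m)`
propagate the bound `p` sites further at a time (`prefixSum_add_le`). A limit along an ultrafilter
solves the full lattice, because a second-order estimate survives it.

The `f j` are the functions with logarithmic derivative `S j` and value `1` at `0`; the bilinear
equations say that a quotient with zero derivative equals its initial value (`mul_tauFunction_eq`).
-/

theorem exists_pos_hasDerivWithinAt_mul {a b : ℝ} (ha : a ≤ 0) (hb : 0 ≤ b) {c : ℝ → ℝ}
    (hc : ContinuousOn c (Icc a b)) :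
    ∃ F : ℝ → ℝ, (∀ t, 0 < F t) ∧ F 0 = 1 ∧
      ∀ t ∈ Icc a b, HasDerivWithinAt F (F t * c t) (Icc a b) t := by
  have hab : a ≤ b := ha.trans hb
  set h : ℝ → ℝ := IccExtend hab ((Icc a b).domRestrict c) with hh
  have hcont : Continuous h := (continuousOn_iff_continuous_domRestrict.1 hc).Icc_extend'
  refine ⟨fun t => Real.exp (∫ s in (0 : ℝ)..t, h s), fun t => Real.exp_pos _, by simp, ?_⟩
  intro t ht
  have h1 : HasDerivAt (fun t => ∫ s in (0 : ℝ)..t, h s) (h t) t :=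
    intervalIntegral.integral_hasDerivAt_right (hcont.intervalIntegrable _ _)
      (hcont.stronglyMeasurableAtFilter _ _) hcont.continuousAt
  have h2 : h t = c t := by
    rw [hh, IccExtend_of_mem hab _ ht]; rfl
  rw [h2] at h1
  exact h1.exp.hasDerivWithinAt

theorem eq_of_hasDerivWithinAt_zero {a b : ℝ} {f : ℝ → ℝ}
    (hf : ∀ t ∈ Icc a b, HasDerivWithinAt f 0 (Icc a b) t) {x y : ℝ} (hx : x ∈ Icc a b)
    (hy : y ∈ Icc a b) : f x = f y := by
  have := (convex_Icc a b).norm_image_sub_le_of_norm_hasDerivWithin_le (C := 0) hf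
    (by simp) hx hy
  rw [zero_mul, norm_le_zero_iff, sub_eq_zero] at this
  exact this.symm

theorem eq_mul_of_hasDerivWithinAt_mul {a b : ℝ} (h0 : (0 : ℝ) ∈ Icc a b) {c y F : ℝ → ℝ}
    (hF : ∀ t, 0 < F t) (hF0 : F 0 = 1)
    (hF' : ∀ t ∈ Icc a b, HasDerivWithinAt F (F t * c t) (Icc a b) t)
    (hy : ∀ t ∈ Icc a b, HasDerivWithinAt y (y t * c t) (Icc a b) t) :
    ∀ t ∈ Icc a b, y t = y 0 * F t := by
  intro t ht
  have := eq_of_hasDerivWithinAt_zero (f := fun t => y t / F t) (a := a) (b := b)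
    (fun t ht => ((hy t ht).fun_div (hF' t ht) (hF t).ne').congr_deriv (by ring)) ht h0
  simp only [hF0, div_one] at this
  rw [← this, div_mul_cancel₀ _ (hF t).ne']

theorem eq_zero_of_hasDerivWithinAt_mul {a b : ℝ} (h0 : (0 : ℝ) ∈ Icc a b) {c y : ℝ → ℝ}
    (hc : ContinuousOn c (Icc a b))
    (hy : ∀ t ∈ Icc a b, HasDerivWithinAt y (y t * c t) (Icc a b) t) (hy0 : y 0 = 0) :
    ∀ t ∈ Icc a b, y t = 0 := by
  obtain ⟨F, hF, hF0, hF'⟩ := exists_pos_hasDerivWithinAt_mul h0.1 h0.2 hc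
  intro t ht
  rw [eq_mul_of_hasDerivWithinAt_mul h0 hF hF0 hF' hy t ht, hy0, zero_mul]

theorem pos_of_hasDerivWithinAt_mul {a b : ℝ} (h0 : (0 : ℝ) ∈ Icc a b) {c y : ℝ → ℝ}
    (hc : ContinuousOn c (Icc a b))
    (hy : ∀ t ∈ Icc a b, HasDerivWithinAt y (y t * c t) (Icc a b) t) (hy0 : 0 < y 0) :
    ∀ t ∈ Icc a b, 0 < y t := by
  obtain ⟨F, hF, hF0, hF'⟩ := exists_pos_hasDerivWithinAt_mul h0.1 h0.2 hc
  intro t ht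
  rw [eq_mul_of_hasDerivWithinAt_mul h0 hF hF0 hF' hy t ht]
  exact mul_pos hy0 (hF t)

theorem monotoneOn_Icc_of_hasDerivWithinAt {a b : ℝ} {f f' : ℝ → ℝ}
    (hf : ∀ t ∈ Icc a b, HasDerivWithinAt f (f' t) (Icc a b) t)
    (h : ∀ t ∈ Icc a b, 0 ≤ f' t) : MonotoneOn f (Icc a b) :=
  monotoneOn_of_hasDerivWithinAt_nonneg (convex_Icc a b) (HasDerivWithinAt.continuousOn hf)
    (fun t ht => (hf t (interior_subset ht)).mono interior_subset)
    (fun t ht => h t (interior_subset ht))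

/-! ### Absolutely monotone functions -/

/-- A sequence of nonnegative functions on `[a, b]`, each the derivative of the previous one. -/
def IsAbsMonotoneSeq (a b : ℝ) (g : ℕ → ℝ → ℝ) : Prop :=
  ∀ n, ∀ t ∈ Icc a b, 0 ≤ g n t ∧ HasDerivWithinAt (g n) (g (n + 1) t) (Icc a b) t

namespace IsAbsMonotoneSeq

variable {a b : ℝ} {g : ℕ → ℝ → ℝ}

theorem succ (hg : IsAbsMonotoneSeq a b g) : IsAbsMonotoneSeq a b (fun n => g (n + 1)) :=
  fun n => hg (n + 1)

theorem mono (hg : IsAbsMonotoneSeq a b g) {a' b' : ℝ} (h : Icc a' b' ⊆ Icc a b) :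
    IsAbsMonotoneSeq a' b' g :=
  fun n t ht => ⟨(hg n t (h ht)).1, (hg n t (h ht)).2.mono h⟩

theorem continuousOn (hg : IsAbsMonotoneSeq a b g) (n : ℕ) : ContinuousOn (g n) (Icc a b) :=
  HasDerivWithinAt.continuousOn fun t ht => (hg n t ht).2

theorem monotoneOn (hg : IsAbsMonotoneSeq a b g) (n : ℕ) : MonotoneOn (g n) (Icc a b) :=
  monotoneOn_Icc_of_hasDerivWithinAt (fun t ht => (hg n t ht).2)
    fun t ht => (hg (n + 1) t ht).1

end IsAbsMonotoneSeq

/-- The remainder of order `n` of the Taylor expansion at `0` of `g 0`, where `g k` is the `k`-th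
derivative. -/
def taylorRemainder (g : ℕ → ℝ → ℝ) (n : ℕ) (x : ℝ) : ℝ :=
  g 0 x - ∑ k ∈ Finset.range n, g k 0 * x ^ k / (k.factorial : ℝ)

theorem hasDerivAt_pow_div_factorial (k : ℕ) (x : ℝ) :
    HasDerivAt (fun x : ℝ => x ^ (k + 1) / ((k + 1).factorial : ℝ)) (x ^ k / (k.factorial : ℝ))
      x := by
  have h := (hasDerivAt_pow (k + 1) x).div_const ((k + 1).factorial : ℝ)
  refine h.congr_deriv ?_
  have h1 : (k.factorial : ℝ) ≠ 0 := by positivity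
  have h2 : ((k : ℝ) + 1) ≠ 0 := by positivity
  rw [Nat.factorial_succ]; push_cast
  field_simp

theorem hasDerivAt_taylorSum (c : ℕ → ℝ) (n : ℕ) (x : ℝ) :
    HasDerivAt (fun x => ∑ k ∈ Finset.range (n + 1), c k * x ^ k / (k.factorial : ℝ))
      (∑ k ∈ Finset.range n, c (k + 1) * x ^ k / (k.factorial : ℝ)) x := by
  simp_rw [Finset.sum_range_succ', mul_div_assoc, pow_zero]
  exact (HasDerivAt.fun_sum fun k (_ : k ∈ Finset.range n) =>
    (hasDerivAt_pow_div_factorial k x).const_mul (c (k + 1))).add_const (c 0 * (1 / _))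

theorem taylorRemainder_zero_right (g : ℕ → ℝ → ℝ) (n : ℕ) : taylorRemainder g (n + 1) 0 = 0 := by
  simp [taylorRemainder, Finset.sum_range_succ']

namespace IsAbsMonotoneSeq

variable {a b : ℝ} {g : ℕ → ℝ → ℝ}

theorem hasDerivWithinAt_taylorRemainder (hg : IsAbsMonotoneSeq a b g) (n : ℕ) {x : ℝ}
    (hx : x ∈ Icc a b) :
    HasDerivWithinAt (taylorRemainder g (n + 1)) (taylorRemainder (fun k => g (k + 1)) n x)
      (Icc a b) x :=
  (hg 0 x hx).2.sub (hasDerivAt_taylorSum (fun k => g k 0) n x).hasDerivWithinAt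

theorem taylorRemainder_nonneg {g : ℕ → ℝ → ℝ} (hg : IsAbsMonotoneSeq 0 b g) (n : ℕ) :
    ∀ x ∈ Icc 0 b, 0 ≤ taylorRemainder g n x := by
  induction n generalizing g with
  | zero => intro x hx; simpa [taylorRemainder] using (hg 0 x hx).1
  | succ n ih =>
    intro x hx
    have hm : MonotoneOn (taylorRemainder g (n + 1)) (Icc 0 b) :=
      monotoneOn_Icc_of_hasDerivWithinAt (fun t ht => hg.hasDerivWithinAt_taylorRemainder n ht)
        fun t ht => ih hg.succ t ht
    have := hm ⟨le_rfl, hx.1.trans hx.2⟩ hx hx.1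
    rwa [taylorRemainder_zero_right] at this

/-- This is the source of convergence to the right of `0`: with `l = y / b` the remainder at `y` is
at most `(y / b) ^ n` times the remainder at `b`, which never exceeds `g 0 b`. The induction
differentiates the difference of the two sides, which vanishes at `0`. -/
theorem taylorRemainder_mul_le {g : ℕ → ℝ → ℝ} (hg : IsAbsMonotoneSeq 0 b g) (n : ℕ) {l : ℝ}
    (hl0 : 0 ≤ l) (hl1 : l ≤ 1) :
    ∀ x ∈ Icc 0 b, taylorRemainder g n (l * x) ≤ l ^ n * taylorRemainder g n x := by
  have hmap : ∀ x ∈ Icc 0 b, l * x ∈ Icc 0 b := fun x hx =>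
    ⟨mul_nonneg hl0 hx.1, (mul_le_of_le_one_left hx.1 hl1).trans hx.2⟩
  induction n generalizing g with
  | zero =>
    intro x hx
    simpa [taylorRemainder] using
      hg.monotoneOn 0 (hmap x hx) hx (mul_le_of_le_one_left hx.1 hl1)
  | succ n ih =>
    intro x hx
    have hm : MonotoneOn (fun x => l ^ (n + 1) * taylorRemainder g (n + 1) x -
        taylorRemainder g (n + 1) (l * x)) (Icc 0 b) := by
      refine monotoneOn_Icc_of_hasDerivWithinAt (f' := fun x =>
        l ^ (n + 1) * taylorRemainder (fun k => g (k + 1)) n x -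
          taylorRemainder (fun k => g (k + 1)) n (l * x) * l) (fun t ht => ?_) fun t ht => ?_
      · refine ((hg.hasDerivWithinAt_taylorRemainder n ht).const_mul _).sub ?_
        refine (hg.hasDerivWithinAt_taylorRemainder n (hmap t ht)).scomp_of_eq t
          (h := fun x => l * x) (h' := l) (s := Icc 0 b) ?_ (fun x hx => hmap x hx) rfl
          |>.congr_deriv (by rw [smul_eq_mul, mul_comm])
        simpa using ((hasDerivAt_id t).const_mul l).hasDerivWithinAt
      · have := mul_le_mul_of_nonneg_right (ih hg.succ t ht) hl0
        simp only [pow_succ]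
        linarith
    have := hm ⟨le_rfl, hx.1.trans hx.2⟩ hx hx.1
    simp only [mul_zero, taylorRemainder_zero_right, sub_zero] at this
    linarith

/-- To the left of `0` every derivative is at most its value at `0`, so the Lagrange bound needs no
other control. Adding or subtracting the remainder from the monotone comparison monomial leaves a
monotone function vanishing at `0`. -/
theorem abs_taylorRemainder_le {g : ℕ → ℝ → ℝ} (hg : IsAbsMonotoneSeq a 0 g) (n : ℕ) :
    ∀ x ∈ Icc a 0, |taylorRemainder g n x| ≤ g n 0 * ((-x) ^ n / (n.factorial : ℝ)) := by
  induction n generalizing g with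
  | zero =>
    intro x hx
    simpa [taylorRemainder, abs_of_nonneg (hg 0 x hx).1] using
      hg.monotoneOn 0 hx ⟨hx.1.trans hx.2, le_rfl⟩ hx.2
  | succ n ih =>
    intro x hx
    have hP : ∀ t, HasDerivAt (fun x : ℝ => -(g (n + 1) 0 * ((-x) ^ (n + 1) /
        ((n + 1).factorial : ℝ)))) (g (n + 1) 0 * ((-t) ^ n / (n.factorial : ℝ))) t := fun t =>
      (((hasDerivAt_pow_div_factorial n (-t)).scomp t (hasDerivAt_neg t)).const_mul
        (g (n + 1) 0)).neg.congr_deriv (by simp)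
    have h1 := monotoneOn_Icc_of_hasDerivWithinAt (a := a) (b := 0) (fun t ht =>
      (hP t).hasDerivWithinAt.add (hg.hasDerivWithinAt_taylorRemainder n ht))
      (fun t ht => by linarith [neg_le_of_abs_le (ih hg.succ t ht)])
    have h2 := monotoneOn_Icc_of_hasDerivWithinAt (a := a) (b := 0) (fun t ht =>
      (hP t).hasDerivWithinAt.sub (hg.hasDerivWithinAt_taylorRemainder n ht))
      (fun t ht => by linarith [le_of_abs_le (ih hg.succ t ht)])
    have h0 : (0 : ℝ) ∈ Icc a 0 := ⟨hx.1.trans hx.2, le_rfl⟩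
    have e1 := h1 hx h0 hx.2
    have e2 := h2 hx h0 hx.2
    simp [taylorRemainder_zero_right] at e1 e2
    exact abs_le.2 ⟨by linarith, by linarith⟩

theorem hasSum_of_tendsto_taylorRemainder {g : ℕ → ℝ → ℝ} {x : ℝ}
    (hs : Summable fun n => g n 0 * x ^ n / (n.factorial : ℝ))
    (h : Tendsto (fun n => taylorRemainder g n x) atTop (𝓝 0)) :
    HasSum (fun n => g n 0 * x ^ n / (n.factorial : ℝ)) (g 0 x) := by
  refine hs.hasSum_iff_tendsto_nat.2 ?_
  have := (tendsto_const_nhds (x := g 0 x)).sub h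
  simpa [taylorRemainder] using this

theorem summable_of_le_geometric {c : ℕ → ℝ} {C A : ℝ} (h0 : ∀ n, 0 ≤ c n)
    (h : ∀ n, c n ≤ C * A ^ n) (x : ℝ) :
    Summable fun n => c n * x ^ n / (n.factorial : ℝ) := by
  refine Summable.of_norm_bounded ((Real.summable_pow_div_factorial (|A| * |x|)).mul_left |C|)
    fun n => ?_
  rw [norm_div, norm_mul, Real.norm_natCast, norm_pow, Real.norm_of_nonneg (h0 n),
    Real.norm_eq_abs, mul_pow, ← mul_div_assoc, ← mul_assoc]
  gcongr
  exact (h n).trans ((le_abs_self _).trans (by rw [abs_mul, abs_pow]))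

/-- Bernstein's theorem: if the derivatives at `0` grow at most geometrically, an absolutely
monotone function is the sum of its Taylor series at `0`. -/
theorem hasSum (hg : IsAbsMonotoneSeq a b g) (ha : a ≤ 0) (hb : 0 ≤ b) {C A : ℝ}
    (hC : ∀ n, g n 0 ≤ C * A ^ n) {x : ℝ} (hx : x ∈ Icc a b) :
    HasSum (fun n => g n 0 * x ^ n / (n.factorial : ℝ)) (g 0 x) := by
  have h00 : ∀ n, 0 ≤ g n 0 := fun n => (hg n 0 ⟨ha, hb⟩).1
  have hs := summable_of_le_geometric h00 hC
  rcases le_total x 0 with hx0 | hx0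
  · have hg' := hg.mono (a' := a) (b' := 0) (Icc_subset_Icc_right hb)
    refine hasSum_of_tendsto_taylorRemainder (hs x) ?_
    refine squeeze_zero_norm (fun n => hg'.abs_taylorRemainder_le n x ⟨hx.1, hx0⟩) ?_
    simpa [mul_div_assoc] using (hs (-x)).tendsto_atTop_zero
  have hg' := hg.mono (a' := 0) (b' := b) (Icc_subset_Icc_left ha)
  have key : ∀ y, 0 ≤ y → y < b →
      HasSum (fun n => g n 0 * y ^ n / (n.factorial : ℝ)) (g 0 y) := by
    intro y hy0 hyb
    have hb0 : 0 < b := hy0.trans_lt hyb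
    refine hasSum_of_tendsto_taylorRemainder (hs y) ?_
    have hl0 : 0 ≤ y / b := by positivity
    have hl1 : y / b < 1 := (div_lt_one hb0).2 hyb
    refine squeeze_zero (g := fun n => (y / b) ^ n * g 0 b)
      (fun n => hg'.taylorRemainder_nonneg n y ⟨hy0, hyb.le⟩) (fun n => ?_) ?_
    · have := hg'.taylorRemainder_mul_le n hl0 hl1.le b ⟨hb, le_rfl⟩
      rw [div_mul_cancel₀ _ hb0.ne'] at this
      refine this.trans (mul_le_mul_of_nonneg_left ?_ (by positivity))
      exact sub_le_self _ (Finset.sum_nonneg fun k _ =>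
        div_nonneg (mul_nonneg (h00 k) (by positivity)) (by positivity))
    · simpa using (tendsto_pow_atTop_nhds_zero_of_lt_one hl0 hl1).mul_const (g 0 b)
  rcases hx.2.lt_or_eq with hxb | rfl
  · exact key x hx0 hxb
  rcases hb.lt_or_eq with hb0 | rfl
  swap
  · rw [hasSum_iff_tendsto_nat_of_summable_norm (hs 0).norm]
    refine tendsto_const_nhds.congr' ?_
    filter_upwards [eventually_ge_atTop 1] with n hn
    obtain ⟨m, rfl⟩ := Nat.exists_eq_add_of_le' hn
    simp [Finset.sum_range_succ']
  -- The scaling argument fails at the right end point. There partial sums are at most `g 0 x`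
  -- because remainders are nonnegative, and the converse inequality comes from continuity and the
  -- expansion at `y < x`.
  have hne : (𝓝[Ico 0 x] x).NeBot := by
    rw [← mem_closure_iff_nhdsWithin_neBot, closure_Ico hb0.ne]; exact ⟨hb, le_rfl⟩
  have hlim : Tendsto (g 0) (𝓝[Ico 0 x] x) (𝓝 (g 0 x)) :=
    ((hg'.continuousOn 0) x ⟨hb, le_rfl⟩).mono Ico_subset_Icc_self
  have hsum : (∑' n, g n 0 * x ^ n / (n.factorial : ℝ)) = g 0 x := by
    refine le_antisymm ((hs x).tsum_le_of_sum_range_le fun n => ?_) ?_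
    · have := hg'.taylorRemainder_nonneg n x ⟨hb, le_rfl⟩
      simp only [taylorRemainder] at this
      linarith
    · refine le_of_tendsto hlim ?_
      filter_upwards [self_mem_nhdsWithin] with y hy
      rw [← (key y hy.1 hy.2).tsum_eq]
      refine (hs y).tsum_le_tsum (fun n => ?_) (hs x)
      have := pow_le_pow_left₀ hy.1 hy.2.le n
      have := h00 n
      gcongr
  rw [← hsum]
  exact (hs x).hasSum

end IsAbsMonotoneSeq

/-! ### Prefix sums of a sequence supported on the positive integers -/

/-- `v 1 + ⋯ + v j`, which is `0` for `j ≤ 0`. -/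
def prefixSum (v : ℤ → ℝ) (j : ℤ) : ℝ := ∑ i ∈ Finset.range j.toNat, v ((i : ℤ) + 1)

theorem prefixSum_of_nonpos (v : ℤ → ℝ) {j : ℤ} (hj : j ≤ 0) : prefixSum v j = 0 := by
  simp [prefixSum, Int.toNat_of_nonpos hj]

theorem prefixSum_eq_add {v : ℤ → ℝ} (hv : ∀ j ≤ 0, v j = 0) (j : ℤ) :
    prefixSum v j = prefixSum v (j - 1) + v j := by
  rcases le_or_gt j 0 with hj | hj
  · rw [prefixSum_of_nonpos _ hj, prefixSum_of_nonpos _ (by omega), hv j hj, add_zero]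
  · obtain ⟨n, rfl⟩ : ∃ n : ℕ, j = (n : ℤ) + 1 := ⟨(j - 1).toNat, by omega⟩
    have h1 : ((n : ℤ) + 1).toNat = n + 1 := by omega
    simp [prefixSum, h1, Finset.sum_range_succ]

theorem prefixSum_nonneg {v : ℤ → ℝ} (hv : ∀ j, 0 ≤ v j) (j : ℤ) : 0 ≤ prefixSum v j :=
  Finset.sum_nonneg fun _ _ => hv _

theorem prefixSum_mono {v : ℤ → ℝ} (hv : ∀ j, 0 ≤ v j) : Monotone (prefixSum v) := by
  intro i j hij
  refine Finset.sum_le_sum_of_subset_of_nonneg ?_ fun _ _ _ => hv _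
  exact Finset.range_mono (Int.toNat_le_toNat hij)

theorem le_prefixSum {v : ℤ → ℝ} (hv : ∀ j, 0 ≤ v j) (hv0 : ∀ j ≤ 0, v j = 0) {i j : ℤ}
    (hij : i ≤ j) : v i ≤ prefixSum v j := by
  have h1 := prefixSum_eq_add hv0 i
  have h2 := prefixSum_nonneg hv (i - 1)
  have h3 := prefixSum_mono hv hij
  linarith

theorem sum_Icc_add_eq {v : ℤ → ℝ} (hv : ∀ j ≤ 0, v j = 0) (p : ℕ) (j : ℤ) :
    ∑ k ∈ Finset.Icc 1 p, v (j + (k : ℤ)) = prefixSum v (j + p) - prefixSum v j := by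
  induction p with
  | zero => simp
  | succ p ih =>
    rw [Finset.sum_Icc_succ_top (by omega), ih, prefixSum_eq_add hv (j + (p + 1 : ℕ))]
    push_cast
    rw [show j + ((p : ℤ) + 1) - 1 = j + p by ring]
    ring

theorem sum_Icc_sub_eq {v : ℤ → ℝ} (hv : ∀ j ≤ 0, v j = 0) (p : ℕ) (j : ℤ) :
    ∑ k ∈ Finset.Icc 1 p, v (j - (k : ℤ)) = prefixSum v (j - 1) - prefixSum v (j - p - 1) := by
  induction p with
  | zero => simp
  | succ p ih =>
    rw [Finset.sum_Icc_succ_top (by omega), ih, prefixSum_eq_add hv (j - p - 1)]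
    push_cast
    rw [show j - ((p : ℤ) + 1) - 1 = j - p - 1 - 1 by ring, show j - ((p : ℤ) + 1) = j - p - 1 by ring]
    ring

/-- The logarithmic derivative of `u_j` along the lattice. -/
def latticeRate (p : ℕ) (v : ℤ → ℝ) (j : ℤ) : ℝ :=
  (∑ k ∈ Finset.Icc 1 p, v (j + (k : ℤ))) - ∑ k ∈ Finset.Icc 1 p, v (j - (k : ℤ))

theorem latticeRate_eq {v : ℤ → ℝ} (hv : ∀ j ≤ 0, v j = 0) (p : ℕ) (j : ℤ) :
    latticeRate p v j = prefixSum v (j + p) - prefixSum v j - prefixSum v (j - 1) +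
      prefixSum v (j - p - 1) := by
  rw [latticeRate, sum_Icc_add_eq hv, sum_Icc_sub_eq hv]
  ring

/-! ### Weighted lattice paths -/

/-- The total weight of the lattice paths from `0` to `k` with `n` steps, each of them `+1` (of
weight `1`) or `-p` (of weight `v (i + 1)` when it ends at `i`). -/
def pathWeight (p : ℕ) (v : ℤ → ℝ) : ℕ → ℤ → ℝ
  | 0, k => if k = 0 then 1 else 0
  | n + 1, k => pathWeight p v n (k - 1) + pathWeight p v n (k + p) * v (k + 1)

theorem pathWeight_zero (p : ℕ) (v : ℤ → ℝ) (k : ℤ) :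
    pathWeight p v 0 k = if k = 0 then 1 else 0 := rfl

theorem pathWeight_succ (p : ℕ) (v : ℤ → ℝ) (n : ℕ) (k : ℤ) : pathWeight p v (n + 1) k =
    pathWeight p v n (k - 1) + pathWeight p v n (k + p) * v (k + 1) := rfl

theorem pathWeight_of_neg {p : ℕ} {v : ℤ → ℝ} (hv : ∀ j ≤ 0, v j = 0) (n : ℕ) :
    ∀ k < 0, pathWeight p v n k = 0 := by
  induction n with
  | zero => intro k hk; simp [pathWeight, hk.ne]
  | succ n ih =>
    intro k hk
    rw [pathWeight, ih _ (by omega), hv _ (by omega), mul_zero, add_zero]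

theorem pathWeight_of_lt {p : ℕ} {v : ℤ → ℝ} (n : ℕ) :
    ∀ k : ℤ, (n : ℤ) < k → pathWeight p v n k = 0 := by
  induction n with
  | zero => intro k hk; simp [pathWeight]; omega
  | succ n ih =>
    intro k hk
    rw [pathWeight, ih _ (by omega), ih _ (by omega), zero_mul, add_zero]

theorem pathWeight_self {p : ℕ} (hp : 1 ≤ p) {v : ℤ → ℝ} (n : ℕ) : pathWeight p v n n = 1 := by
  induction n with
  | zero => simp [pathWeight]
  | succ n ih =>
    rw [pathWeight, pathWeight_of_lt n (_ + (p : ℤ)) (by push_cast; omega), zero_mul, add_zero]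
    simpa using ih

theorem pathWeight_of_le {p : ℕ} {v : ℤ → ℝ} (hv : ∀ j ≤ 0, v j = 0) {n : ℕ} (hn : n ≤ p) :
    ∀ k : ℤ, pathWeight p v n k = if k = n then 1 else 0 := by
  induction n with
  | zero => intro k; simp [pathWeight]
  | succ n ih =>
    intro k
    rw [pathWeight, ih (by omega), ih (by omega)]
    by_cases hk : k + p = n
    · rw [hv (k + 1) (by omega), mul_zero, add_zero]
      congr 1
      simp; omega
    · rw [if_neg hk, zero_mul, add_zero]
      congr 1
      simp; omega

theorem pathWeight_nonneg {p : ℕ} {v : ℤ → ℝ} (hv : ∀ j, 0 ≤ v j) (n : ℕ) :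
    ∀ k, 0 ≤ pathWeight p v n k := by
  induction n with
  | zero => intro k; rw [pathWeight]; split_ifs <;> simp
  | succ n ih => intro k; exact add_nonneg (ih _) (mul_nonneg (ih _) (hv _))

theorem pathWeight_le {p : ℕ} {v : ℤ → ℝ} (hv : ∀ j, 0 ≤ v j) (hv1 : ∀ j, v j ≤ 1) (n : ℕ) :
    ∀ k, pathWeight p v n k ≤ 2 ^ n := by
  induction n with
  | zero => intro k; rw [pathWeight]; split_ifs <;> simp
  | succ n ih =>
    intro k
    have h1 := ih (k - 1)
    have h2 := mul_le_of_le_one_right (pathWeight_nonneg (p := p) hv n (k + p)) (hv1 (k + 1))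
    have h3 := ih (k + p)
    rw [pathWeight, pow_succ]
    linarith

/-- The unit step. -/
def unitStep (j : ℤ) : ℝ := if j ≤ 0 then 0 else 1

/-- A down-step below `0` has weight `0`, so this counts paths with `n` down-steps of size `p` that
stay nonnegative: a generalized ballot number. The closed form satisfies the same recurrence. -/
theorem pathWeight_unitStep {p : ℕ} (hp : 1 ≤ p) (m : ℕ) :
    ∀ n k : ℕ, m = (p + 1) * n + k → pathWeight p unitStep m k =
      ((k : ℝ) + 1) * m.factorial / (n.factorial * (p * n + k + 1).factorial) := by
  have hv : ∀ j ≤ 0, unitStep j = 0 := fun j hj => if_pos hj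
  induction m with
  | zero =>
    intro n k h
    obtain ⟨rfl, rfl⟩ : n = 0 ∧ k = 0 := by
      constructor <;> by_contra hne <;> have := Nat.pos_of_ne_zero hne <;> nlinarith
    simp [pathWeight]
  | succ m ih =>
    intro n k h
    rcases n with _ | n
    · obtain rfl : k = m + 1 := by omega
      rw [pathWeight_self hp]
      have : ((m + 1 + 1).factorial : ℝ) = ((m + 1 : ℕ) + 1 : ℝ) * (m + 1).factorial := by
        rw [Nat.factorial_succ (m + 1)]; push_cast; ring
      simp only [mul_zero, zero_add, Nat.factorial_zero, Nat.cast_one, one_mul]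
      rw [this, div_self (by positivity)]
    have h1 : pathWeight p unitStep m ((k : ℤ) - 1) =
        (k : ℝ) * m.factorial / ((n + 1).factorial * (p * (n + 1) + k).factorial) := by
      rcases k with _ | k
      -- At `k = 0` the up-step would come from `-1`; the factor `k` in the formula vanishes
      -- accordingly.
      · rw [pathWeight_of_neg hv _ _ (by simp)]; simp
      · have := ih (n + 1) k (by omega)
        push_cast at this ⊢
        rw [add_sub_cancel_right, this, add_assoc]
    have h2 := ih n (k + p) (by rw [mul_add] at h; omega)
    rw [pathWeight, h1, show unitStep ((k : ℤ) + 1) = 1 from if_neg (by omega), mul_one]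
    push_cast at h2
    rw [h2]
    have e1 : p * n + (k + p) + 1 = p * (n + 1) + k + 1 := by ring
    have hm : ((m : ℝ) + 1) = (p + 1) * (n + 1) + k := by exact_mod_cast h
    rw [e1, Nat.factorial_succ m, Nat.factorial_succ n, Nat.factorial_succ (p * (n + 1) + k)]
    push_cast
    rw [hm]
    have p1 : (m.factorial : ℝ) ≠ 0 := by positivity
    have p2 : (n.factorial : ℝ) ≠ 0 := by positivity
    have p3 : ((p * (n + 1) + k).factorial : ℝ) ≠ 0 := by positivity
    have p4 : (p * ((n : ℝ) + 1) + k + 1) ≠ 0 := by positivity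
    have p5 : ((n : ℝ) + 1) ≠ 0 := by positivity
    field_simp
    ring

/-! ### Path weights along a solution of the lattice -/

section

variable {p : ℕ} {I : Set ℝ} {u : ℤ → ℝ → ℝ}

theorem IsBogoyavlenskySolution.hasDerivWithinAt (hu : IsBogoyavlenskySolution p I u) (j : ℤ)
    {t : ℝ} (ht : t ∈ I) :
    HasDerivWithinAt (u j) (u j t * latticeRate p (fun i => u i t) j) I t :=
  hu j t ht

theorem IsBogoyavlenskySolution.mono (hu : IsBogoyavlenskySolution p I u) {J : Set ℝ}
    (h : J ⊆ I) : IsBogoyavlenskySolution p J u :=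
  fun j t ht => (hu j t (h ht)).mono h

theorem IsBogoyavlenskySolution.continuousOn (hu : IsBogoyavlenskySolution p I u) (j : ℤ) :
    ContinuousOn (u j) I :=
  HasDerivWithinAt.continuousOn (hu j)

theorem IsBogoyavlenskySolution.continuousOn_prefixSum (hu : IsBogoyavlenskySolution p I u)
    (j : ℤ) : ContinuousOn (fun t => prefixSum (fun i => u i t) j) I :=
  continuousOn_finsetSum _ fun _ _ => hu.continuousOn _

theorem IsBogoyavlenskySolution.continuousOn_latticeRate (hu : IsBogoyavlenskySolution p I u)
    (j : ℤ) : ContinuousOn (fun t => latticeRate p (fun i => u i t) j) I :=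
  (continuousOn_finsetSum _ fun _ _ => hu.continuousOn _).sub
    (continuousOn_finsetSum _ fun _ _ => hu.continuousOn _)

/-- The Lax equation, applied to the first row of the powers of the Lax operator. -/
theorem hasDerivWithinAt_pathWeight (hu : IsBogoyavlenskySolution p I u)
    (hu0 : ∀ j ≤ 0, ∀ t ∈ I, u j t = 0) {t : ℝ} (ht : t ∈ I) (n : ℕ) :
    ∀ k : ℤ, HasDerivWithinAt (fun s => pathWeight p (fun i => u i s) n k)
      (pathWeight p (fun i => u i t) (n + p + 1) k - pathWeight p (fun i => u i t) n (k - p - 1) -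
        (prefixSum (fun i => u i t) (k + 1) - prefixSum (fun i => u i t) (k - p)) *
          pathWeight p (fun i => u i t) n k) I t := by
  have hv : ∀ j ≤ 0, (fun i => u i t) j = 0 := fun j hj => hu0 j hj t ht
  induction n with
  | zero =>
    intro k
    refine (hasDerivWithinAt_const t I _).congr_deriv ?_
    rw [zero_add, pathWeight_succ, pathWeight_of_le hv le_rfl, pathWeight_of_le hv le_rfl,
      pathWeight_zero, pathWeight_zero]
    rcases eq_or_ne k 0 with rfl | hk
    · have h1 := prefixSum_eq_add hv (0 + 1)
      have h2 := prefixSum_of_nonpos (fun i => u i t) (j := 0) le_rfl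
      have h3 := prefixSum_of_nonpos (fun i => u i t) (j := 0 - p) (by omega)
      rw [if_neg (by omega), if_pos (by omega), if_neg (by omega), if_pos rfl, h3, h1]
      simp [h2]
    · rw [if_neg (show ¬ k + p = p by omega), if_neg hk]
      by_cases h : k - 1 = p
      · rw [if_pos h, if_pos (by omega)]; ring
      · rw [if_neg h, if_neg (by omega)]; ring
  | succ n ih =>
    intro k
    refine ((ih (k - 1)).add ((ih (k + p)).mul (hu.hasDerivWithinAt (k + 1) ht))).congr_deriv ?_
    rw [latticeRate_eq hv]
    have e : n + 1 + p + 1 = (n + p + 1) + 1 := by ring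
    rw [e]
    simp only [pathWeight_succ]
    have a1 := prefixSum_eq_add hv (k + 1)
    have a2 := prefixSum_eq_add hv (k - p)
    have b3 : k - p - 1 + p = k - 1 := by ring
    have b4 : k + 1 + p = k + p + 1 := by ring
    have b5 : k + 1 - p - 1 = k - p := by ring
    have b6 : k - 1 - p = k - p - 1 := by ring
    simp only [b3, b4, b5, b6, add_sub_cancel_right, sub_add_cancel] at a1 a2 ⊢
    rw [a1, a2]
    ring

/-- For `0 ≤ k ≤ p` the indices `k - p - 1` and `k - p` are out of range, so two terms of the Lax
equation vanish, and the factor `F` absorbs the remaining term in `S (k+1)`. Differentiation then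
merely lengthens the paths by `p + 1` steps. -/
theorem isAbsMonotoneSeq_pathWeight {a b : ℝ} (hu : IsBogoyavlenskySolution p (Icc a b) u)
    (hu0 : ∀ j ≤ 0, ∀ t ∈ Icc a b, u j t = 0) (hpos : ∀ j, ∀ t ∈ Icc a b, 0 ≤ u j t) {k : ℕ}
    (hk : k ≤ p) {F : ℝ → ℝ} (hF : ∀ t ∈ Icc a b, 0 ≤ F t)
    (hF' : ∀ t ∈ Icc a b, HasDerivWithinAt F (F t * prefixSum (fun i => u i t) (k + 1))
      (Icc a b) t) :
    IsAbsMonotoneSeq a b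
      (fun n t => F t * pathWeight p (fun i => u i t) ((p + 1) * n + k) k) := by
  intro n t ht
  have hv : ∀ j ≤ 0, (fun i => u i t) j = 0 := fun j hj => hu0 j hj t ht
  refine ⟨mul_nonneg (hF t ht) (pathWeight_nonneg (fun j => hpos j t ht) _ _), ?_⟩
  refine ((hF' t ht).mul (hasDerivWithinAt_pathWeight hu hu0 ht _ _)).congr_deriv ?_
  beta_reduce
  rw [pathWeight_of_neg hv _ (k - p - 1) (by omega), prefixSum_of_nonpos _ (j := k - p) (by omega),
    show (p + 1) * (n + 1) + k = (p + 1) * n + k + p + 1 by ring]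
  ring

theorem hasSum_pathWeight (hp : 1 ≤ p) {a b : ℝ} (h0 : (0 : ℝ) ∈ Icc a b)
    (hu : IsBogoyavlenskySolution p (Icc a b) u)
    (hu0 : ∀ j ≤ 0, ∀ t ∈ Icc a b, u j t = 0) (hpos : ∀ j, ∀ t ∈ Icc a b, 0 ≤ u j t)
    (hu1 : ∀ j, u j 0 ≤ 1) {k : ℕ}
    (hk : k ≤ p) {F : ℝ → ℝ} (hF : ∀ t ∈ Icc a b, 0 ≤ F t) (hF0 : F 0 = 1)
    (hF' : ∀ t ∈ Icc a b, HasDerivWithinAt F (F t * prefixSum (fun i => u i t) (k + 1))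
      (Icc a b) t) {x : ℝ} (hx : x ∈ Icc a b) :
    HasSum (fun n => pathWeight p (fun i => u i 0) ((p + 1) * n + k) k * x ^ n /
        (n.factorial : ℝ)) (F x) := by
  have h := (isAbsMonotoneSeq_pathWeight hu hu0 hpos hk hF hF').hasSum h0.1 h0.2
    (C := 2 ^ k) (A := 2 ^ (p + 1)) (fun n => by
      rw [hF0, one_mul, ← pow_mul, ← pow_add, add_comm k]
      exact pathWeight_le (fun j => hpos j 0 h0) hu1 _ _) hx
  simpa [hF0, pathWeight_self hp] using h

/-- The same expansion for the derivative: the second function of the sequence is identified with `F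
* S (k+1)` by uniqueness of derivatives, which needs a nondegenerate interval. -/
theorem hasSum_pathWeight_succ (hp : 1 ≤ p) {a b : ℝ} (hab : a < b) (h0 : (0 : ℝ) ∈ Icc a b)
    (hu : IsBogoyavlenskySolution p (Icc a b) u)
    (hu0 : ∀ j ≤ 0, ∀ t ∈ Icc a b, u j t = 0) (hpos : ∀ j, ∀ t ∈ Icc a b, 0 ≤ u j t)
    (hu1 : ∀ j, u j 0 ≤ 1) {k : ℕ}
    (hk : k ≤ p) {F : ℝ → ℝ} (hF : ∀ t ∈ Icc a b, 0 ≤ F t) (hF0 : F 0 = 1)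
    (hF' : ∀ t ∈ Icc a b, HasDerivWithinAt F (F t * prefixSum (fun i => u i t) (k + 1))
      (Icc a b) t) {x : ℝ} (hx : x ∈ Icc a b) :
    HasSum (fun n => pathWeight p (fun i => u i 0) ((p + 1) * (n + 1) + k) k * x ^ n /
        (n.factorial : ℝ)) (F x * prefixSum (fun i => u i x) (k + 1)) := by
  have hg := isAbsMonotoneSeq_pathWeight hu hu0 hpos hk hF hF'
  have h := hg.succ.hasSum h0.1 h0.2
    (C := 2 ^ (p + 1 + k)) (A := 2 ^ (p + 1)) (fun n => by
      rw [hF0, one_mul, ← pow_mul, ← pow_add]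
      refine (pathWeight_le (fun j => hpos j 0 h0) hu1 _ _).trans_eq ?_
      congr 1; ring) hx
  have h1 := (hg 0 x hx).2
  simp only [mul_zero, zero_add, pathWeight_self hp, mul_one] at h1
  have h2 := (uniqueDiffOn_Icc hab x hx).eq_deriv _ h1 (hF' x hx)
  simp only [hF0, one_mul, zero_add, mul_one, h2] at h
  exact h

end

/-! ### The hypergeometric coefficients -/

/-- Gauss's multiplication formula at integers: split the factors from `k + 1` to `k + q * n` by
residue modulo `q`. -/
theorem prod_ascPochhammer_eval {q : ℕ} (hq : 1 ≤ q) (k n : ℕ) :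
    (k.factorial : ℝ) * (q : ℝ) ^ (q * n) *
      ∏ i ∈ Finset.range q, (ascPochhammer ℝ n).eval (((k + 1 + i : ℕ) : ℝ) / q) =
      (k + q * n).factorial := by
  have hq0 : (q : ℝ) ≠ 0 := by positivity
  induction n with
  | zero => simp
  | succ n ih =>
    have h1 : ((k + q * (n + 1)).factorial : ℝ) = (k + q * n).factorial *
        ∏ i ∈ Finset.range q, ((k + 1 + i : ℕ) + q * n : ℝ) := by
      rw [mul_add, mul_one, ← add_assoc, ← Nat.factorial_mul_ascFactorial,
        Nat.ascFactorial_eq_prod_range]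
      push_cast
      congr 1
      refine Finset.prod_congr rfl fun i _ => ?_
      ring
    have h2 : ∏ i ∈ Finset.range q, ((k + 1 + i : ℕ) + q * n : ℝ) =
        (q : ℝ) ^ q * ∏ i ∈ Finset.range q, (((k + 1 + i : ℕ) : ℝ) / q + n) := by
      have h3 : (q : ℝ) ^ q = ∏ _i ∈ Finset.range q, (q : ℝ) := by simp
      rw [h3, ← Finset.prod_mul_distrib]
      refine Finset.prod_congr rfl fun i _ => ?_
      field_simp
    rw [h1, h2, ← ih]
    simp_rw [ascPochhammer_succ_eval]
    rw [Finset.prod_mul_distrib, mul_add, mul_one, pow_add]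
    ring

/-- The omitted parameter `1` contributes `(1)ₙ = n!`, which is the extra factorial here. -/
theorem prod_map_stepUpper {p k : ℕ} (hk : k ≤ p) (n : ℕ) :
    (k.factorial : ℝ) * ((p : ℝ) + 1) ^ ((p + 1) * n) * (n.factorial *
      ((stepUpper p (k + 1)).map fun x => (ascPochhammer ℝ n).eval x).prod) =
      ((p + 1) * n + k).factorial := by
  have h := prod_ascPochhammer_eval (q := p + 1) (by omega) k n
  have h1 : ∏ i ∈ Finset.range (p + 1),
      (ascPochhammer ℝ n).eval (((k + 1 + i : ℕ) : ℝ) / ((p + 1 : ℕ) : ℝ)) =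
      ∏ m ∈ Finset.Icc (k + 1) (k + 1 + p), (ascPochhammer ℝ n).eval ((m : ℝ) / ((p : ℝ) + 1)) := by
    rw [← Finset.Ico_add_one_right_eq_Icc, Finset.prod_Ico_eq_prod_range]
    rw [show k + 1 + p + 1 - (k + 1) = p + 1 by omega]
    push_cast
    rfl
  rw [h1, ← Finset.mul_prod_erase _ _ (show p + 1 ∈ Finset.Icc (k + 1) (k + 1 + p) by
    rw [Finset.mem_Icc]; omega)] at h
  have hp1 : ((p : ℝ) + 1) ≠ 0 := by positivity
  push_cast at h
  rw [div_self hp1, ascPochhammer_eval_one] at h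
  rw [stepUpper, add_comm ((p + 1) * n) k]
  simp only [Multiset.bind_def, Multiset.pure_def, Multiset.bind_singleton, Multiset.map_map]
  exact h

theorem prod_map_stepLower {p : ℕ} (hp : 1 ≤ p) (k n : ℕ) :
    ((k + 1).factorial : ℝ) * (p : ℝ) ^ (p * n) *
      ((stepLower p (k + 1)).map fun x => (ascPochhammer ℝ n).eval x).prod =
      (p * n + k + 1).factorial := by
  have h := prod_ascPochhammer_eval hp (k + 1) n
  have h1 : ∏ i ∈ Finset.range p, (ascPochhammer ℝ n).eval (((k + 1 + 1 + i : ℕ) : ℝ) / (p : ℝ)) =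
      ∏ m ∈ Finset.Icc (k + 1 + 1) (k + 1 + p), (ascPochhammer ℝ n).eval ((m : ℝ) / (p : ℝ)) := by
    rw [← Finset.Ico_add_one_right_eq_Icc, Finset.prod_Ico_eq_prod_range]
    rw [show k + 1 + p + 1 - (k + 1 + 1) = p by omega]
  rw [h1] at h
  rw [stepLower, show p * n + k + 1 = k + 1 + p * n by ring]
  simp only [Multiset.bind_def, Multiset.pure_def, Multiset.bind_singleton, Multiset.map_map]
  exact h

theorem hypTerm_step {p k : ℕ} (hp : 1 ≤ p) (hk : k ≤ p) (t : ℝ) (n : ℕ) :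
    hypTerm (stepUpper p (k + 1)) (stepLower p (k + 1)) (stepScale p * t) n =
      pathWeight p unitStep ((p + 1) * n + k) k * t ^ n / (n.factorial : ℝ) := by
  have hU := prod_map_stepUpper hk n
  have hL := prod_map_stepLower hp k n
  rw [pathWeight_unitStep hp _ n k rfl, hypTerm]
  set U := ((stepUpper p (k + 1)).map fun x => (ascPochhammer ℝ n).eval x).prod
  set L := ((stepLower p (k + 1)).map fun x => (ascPochhammer ℝ n).eval x).prod
  have hL0 : L ≠ 0 := by
    intro h
    rw [h, mul_zero] at hL
    exact (Nat.factorial_ne_zero _) (by exact_mod_cast hL.symm)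
  rw [stepScale, mul_pow, div_pow, ← pow_mul, ← pow_mul, ← hL, ← hU, Nat.factorial_succ]
  have hp0 : (p : ℝ) ≠ 0 := by positivity
  have hp1 : ((p : ℝ) + 1) ≠ 0 := by positivity
  have k1 : (k.factorial : ℝ) ≠ 0 := by positivity
  have n1 : (n.factorial : ℝ) ≠ 0 := by positivity
  have k2 : ((k : ℝ) + 1) ≠ 0 := by positivity
  push_cast
  field_simp

theorem stepScale_ne_zero {p : ℕ} (hp : 1 ≤ p) : stepScale p ≠ 0 := by
  rw [stepScale]; positivity

/-! ### The flux through a site -/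

/-- Interactions within `1, …, j` cancel; what remains are products of pairs at distance at most `p`
straddling the bond after `j`. Hence prefix sums grow in time for nonnegative data, and the total
over a truncated lattice is conserved. -/
theorem sum_range_mul_latticeRate {v : ℤ → ℝ} (hv : ∀ j ≤ 0, v j = 0) (p j : ℕ) :
    ∑ i ∈ Finset.range j, v ((i : ℤ) + 1) * latticeRate p v ((i : ℤ) + 1) =
      ∑ k ∈ Finset.Icc 1 p, ∑ i ∈ Finset.range k, v ((j : ℤ) - i) * v ((j : ℤ) - i + k) := by
  induction j with
  | zero =>
    simp only [Finset.range_zero, Finset.sum_empty]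
    refine (Finset.sum_eq_zero fun k _ => Finset.sum_eq_zero fun i _ => ?_).symm
    rw [hv _ (by simp), zero_mul]
  | succ j ih =>
    rw [Finset.sum_range_succ, ih, latticeRate, mul_sub, Finset.mul_sum, Finset.mul_sum,
      ← Finset.sum_sub_distrib, ← Finset.sum_add_distrib]
    refine Finset.sum_congr rfl fun k _ => ?_
    have h1 := Finset.sum_range_succ
      (fun i : ℕ => v ((j : ℤ) + 1 - i) * v ((j : ℤ) + 1 - i + k)) k
    rw [Finset.sum_range_succ'] at h1
    have h2 : ∀ i : ℕ, (j : ℤ) + 1 - (i + 1 : ℕ) = j - i := fun i => by push_cast; ring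
    simp only [h2] at h1
    push_cast at h1 ⊢
    rw [sub_zero, sub_add_cancel] at h1
    linarith

theorem IsBogoyavlenskySolution.hasDerivWithinAt_prefixSum {p : ℕ} {I : Set ℝ} {u : ℤ → ℝ → ℝ}
    (hu : IsBogoyavlenskySolution p I u) (hu0 : ∀ j ≤ 0, ∀ t ∈ I, u j t = 0) (j : ℤ) {t : ℝ}
    (ht : t ∈ I) :
    HasDerivWithinAt (fun t => prefixSum (fun i => u i t) j)
      (∑ k ∈ Finset.Icc 1 p, ∑ i ∈ Finset.range k,
        u ((j.toNat : ℤ) - i) t * u ((j.toNat : ℤ) - i + k) t) I t := by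
  rw [← sum_range_mul_latticeRate (v := fun i => u i t) (fun j hj => hu0 j hj t ht)]
  exact HasDerivWithinAt.fun_sum fun i _ => hu.hasDerivWithinAt _ ht

theorem monotoneOn_prefixSum {p : ℕ} {a b : ℝ} {u : ℤ → ℝ → ℝ}
    (hu : IsBogoyavlenskySolution p (Icc a b) u) (hu0 : ∀ j ≤ 0, ∀ t ∈ Icc a b, u j t = 0)
    (hpos : ∀ j, ∀ t ∈ Icc a b, 0 ≤ u j t) (j : ℤ) :
    MonotoneOn (fun t => prefixSum (fun i => u i t) j) (Icc a b) :=
  monotoneOn_Icc_of_hasDerivWithinAt (fun _ ht => hu.hasDerivWithinAt_prefixSum hu0 j ht)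
    fun t ht => Finset.sum_nonneg fun _ _ => Finset.sum_nonneg fun _ _ =>
      mul_nonneg (hpos _ t ht) (hpos _ t ht)

theorem IsBogoyavlenskySolution.eq_zero {p : ℕ} {a b : ℝ} {u : ℤ → ℝ → ℝ}
    (hu : IsBogoyavlenskySolution p (Icc a b) u) (h0 : (0 : ℝ) ∈ Icc a b) {j : ℤ}
    (hj : u j 0 = 0) : ∀ t ∈ Icc a b, u j t = 0 :=
  eq_zero_of_hasDerivWithinAt_mul h0 (hu.continuousOn_latticeRate j)
    (fun _ ht => hu.hasDerivWithinAt j ht) hj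

theorem IsBogoyavlenskySolution.pos {p : ℕ} {a b : ℝ} {u : ℤ → ℝ → ℝ}
    (hu : IsBogoyavlenskySolution p (Icc a b) u) (h0 : (0 : ℝ) ∈ Icc a b) {j : ℤ}
    (hj : 0 < u j 0) : ∀ t ∈ Icc a b, 0 < u j t :=
  pos_of_hasDerivWithinAt_mul h0 (hu.continuousOn_latticeRate j)
    (fun _ ht => hu.hasDerivWithinAt j ht) hj

/-! ### The truncated lattice -/

/-- Extension by zero of a finite sequence, placed at the sites `1, …, N`. -/
def extendZero {N : ℕ} (x : Fin N → ℝ) (j : ℤ) : ℝ :=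
  if h : 1 ≤ j ∧ j ≤ N then x ⟨(j - 1).toNat, by omega⟩ else 0

theorem extendZero_of_nonpos {N : ℕ} (x : Fin N → ℝ) {j : ℤ} (hj : j ≤ 0) : extendZero x j = 0 :=
  dif_neg (by omega)

theorem extendZero_of_lt {N : ℕ} (x : Fin N → ℝ) {j : ℤ} (hj : N < j) : extendZero x j = 0 :=
  dif_neg (by omega)

theorem extendZero_succ {N : ℕ} (x : Fin N → ℝ) (i : Fin N) :
    extendZero x ((i : ℤ) + 1) = x i := by
  rw [extendZero, dif_pos (by omega)]
  congr 1
  ext; simp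

theorem contDiff_extendZero {N : ℕ} (j : ℤ) :
    ContDiff ℝ 1 (fun x : Fin N → ℝ => extendZero x j) := by
  unfold extendZero
  split_ifs
  · fun_prop
  · fun_prop

/-- The vector field of the lattice truncated to the sites `1, …, N`. -/
def truncatedField (p N : ℕ) (x : Fin N → ℝ) (i : Fin N) : ℝ :=
  extendZero x ((i : ℤ) + 1) * latticeRate p (extendZero x) ((i : ℤ) + 1)

theorem contDiff_latticeRate_extendZero {N : ℕ} (p : ℕ) (j : ℤ) :
    ContDiff ℝ 1 (fun x : Fin N → ℝ => latticeRate p (extendZero x) j) :=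
  (ContDiff.sum fun _ _ => contDiff_extendZero _).sub
    (ContDiff.sum fun _ _ => contDiff_extendZero _)

theorem contDiff_truncatedField (p N : ℕ) : ContDiff ℝ 1 (truncatedField p N) :=
  contDiff_pi.2 fun _ => (contDiff_extendZero _).mul (contDiff_latticeRate_extendZero p _)

theorem sum_truncatedField (p N : ℕ) (x : Fin N → ℝ) : ∑ i, truncatedField p N x i = 0 := by
  have h := sum_range_mul_latticeRate (fun j hj => extendZero_of_nonpos x hj) p N
  rw [← Fin.sum_univ_eq_sum_range
    (fun i => extendZero x ((i : ℤ) + 1) * latticeRate p (extendZero x) ((i : ℤ) + 1))] at h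
  refine h.trans (Finset.sum_eq_zero fun k _ => Finset.sum_eq_zero fun i hi => ?_)
  rw [Finset.mem_range] at hi
  rw [extendZero_of_lt x (j := (N : ℤ) - i + k) (by omega), mul_zero]

/-- The coordinatewise projection onto the cube `[-N, N]ᴺ`. -/
def clampCube {N : ℕ} (x : Fin N → ℝ) (i : Fin N) : ℝ := max (-(N : ℝ)) (min N (x i))

theorem clampCube_mem {N : ℕ} (x : Fin N → ℝ) :
    clampCube x ∈ Metric.closedBall (0 : Fin N → ℝ) N := by
  rw [mem_closedBall_zero_iff, pi_norm_le_iff_of_nonneg (by positivity)]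
  intro i
  have : (0 : ℝ) ≤ N := by positivity
  rw [Real.norm_eq_abs, abs_le]
  exact ⟨le_max_left _ _, max_le (by linarith) (min_le_left _ _)⟩

theorem lipschitzWith_clampCube (N : ℕ) : LipschitzWith 1 (clampCube (N := N)) := by
  refine LipschitzWith.of_dist_le_mul fun x y => ?_
  rw [NNReal.coe_one, one_mul, dist_pi_le_iff dist_nonneg]
  intro i
  have h := ((LipschitzWith.id (α := ℝ)).const_min (N : ℝ)).const_max (-(N : ℝ))
  have := h.dist_le_mul (x i) (y i)
  rw [NNReal.coe_one, one_mul] at this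
  exact this.trans (dist_le_pi_dist x y i)

/-- In multiplicative form the clamped equation for each coordinate is still scalar linear, so
positivity survives the clamping. -/
theorem clamp_eq_mul {N x : ℝ} (hN : 0 < N) : max (-N) (min N x) = x * (N / max N |x|) := by
  rcases le_total |x| N with h | h
  · rw [max_eq_left h, div_self hN.ne', mul_one]
    rw [abs_le] at h
    rw [min_eq_right h.2, max_eq_right h.1]
  · rw [max_eq_right h]
    have hx : 0 < |x| := hN.trans_le h
    rcases le_total 0 x with h0 | h0
    · rw [abs_of_nonneg h0] at *
      rw [min_eq_left h, max_eq_right (by linarith)]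
      field_simp
    · rw [abs_of_nonpos h0] at *
      rw [min_eq_right (by linarith), max_eq_left (by linarith)]
      have : x ≠ 0 := by linarith
      field_simp

theorem exists_hasDerivWithinAt_clamped (p N : ℕ) :
    ∃ α : ℝ → Fin N → ℝ, α 0 = (fun _ => 1) ∧ ∀ t ∈ Icc (-(N : ℝ)) N,
      HasDerivWithinAt α (truncatedField p N (clampCube (α t))) (Icc (-(N : ℝ)) N) t := by
  have hC := contDiff_truncatedField p N
  have hcpt := isCompact_closedBall (0 : Fin N → ℝ) N
  obtain ⟨K, hK⟩ := hC.contDiffOn.exists_lipschitzOnWith one_ne_zero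
    (convex_closedBall (0 : Fin N → ℝ) N) hcpt
  obtain ⟨L, hL⟩ := hcpt.exists_bound_of_continuousOn hC.continuous.continuousOn
  have hN : (0 : ℝ) ∈ Icc (-(N : ℝ)) N := by constructor <;> simp
  -- The clamped field is bounded by `L` and Lipschitz everywhere, so a ball of radius `L * N`
  -- allows the whole time interval `[-N, N]`.
  have h := IsPicardLindelof.of_time_independent (f := fun x => truncatedField p N (clampCube x))
    (t₀ := ⟨0, hN⟩) (x₀ := fun _ : Fin N => (1 : ℝ)) (a := L.toNNReal * N) (r := 0)
    (L := L.toNNReal) (K := K * 1)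
    (fun x _ => (hL _ (clampCube_mem x)).trans (Real.le_coe_toNNReal L))
    (hK.comp (lipschitzWith_clampCube N).lipschitzOnWith fun x _ => clampCube_mem x)
    (by simp)
  exact h.exists_eq_forall_mem_Icc_hasDerivWithinAt₀

/-- A solution on `[-N, N]` of the lattice with initial data `1` at the sites `1, …, N` and `0`
elsewhere. -/
structure IsTruncatedSolution (p N : ℕ) (u : ℤ → ℝ → ℝ) : Prop where
  isSolution : IsBogoyavlenskySolution p (Icc (-(N : ℝ)) N) u
  apply_zero : ∀ j : ℤ, u j 0 = if 1 ≤ j ∧ j ≤ N then 1 else 0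

/-- The clamped solution has positive coordinates with conserved sum `N`, so no coordinate exceeds
`N` and the clamping never acts. -/
theorem exists_isTruncatedSolution (p : ℕ) {N : ℕ} (hN : 1 ≤ N) :
    ∃ u, IsTruncatedSolution p N u := by
  obtain ⟨α, hα0, hα⟩ := exists_hasDerivWithinAt_clamped p N
  have hN0 : (0 : ℝ) < N := by positivity
  have h0 : (0 : ℝ) ∈ Icc (-(N : ℝ)) N := by constructor <;> simp
  have hcont : ContinuousOn α (Icc (-(N : ℝ)) N) := HasDerivWithinAt.continuousOn hα
  have hi : ∀ i, ∀ t ∈ Icc (-(N : ℝ)) N, HasDerivWithinAt (fun t => α t i)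
      (truncatedField p N (clampCube (α t)) i) (Icc (-(N : ℝ)) N) t :=
    fun i t ht => hasDerivWithinAt_pi.1 (hα t ht) i
  have hpos : ∀ i, ∀ t ∈ Icc (-(N : ℝ)) N, 0 < α t i := by
    intro i
    have hci : ContinuousOn (fun t => α t i) (Icc (-(N : ℝ)) N) :=
      HasDerivWithinAt.continuousOn (hi i)
    refine pos_of_hasDerivWithinAt_mul h0 (c := fun t => N / max (N : ℝ) |α t i| *
      latticeRate p (extendZero (clampCube (α t))) ((i : ℤ) + 1)) ?_ (fun t ht => ?_)
      (by simp [hα0])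
    · refine ContinuousOn.mul (continuousOn_const.div (continuousOn_const.sup hci.abs)
        fun t _ => (hN0.trans_le (le_max_left _ _)).ne') ?_
      exact ((contDiff_latticeRate_extendZero p _).continuous.comp
        (lipschitzWith_clampCube N).continuous).comp_continuousOn hcont
    · refine (hi i t ht).congr_deriv ?_
      rw [truncatedField, extendZero_succ, clampCube, clamp_eq_mul hN0, mul_assoc]
  have hsum : ∀ t ∈ Icc (-(N : ℝ)) N, ∑ i, α t i = N := by
    intro t ht
    have := eq_of_hasDerivWithinAt_zero (f := fun t => ∑ i, α t i) (fun t ht =>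
      (HasDerivWithinAt.fun_sum fun i (_ : i ∈ Finset.univ) => hi i t ht).congr_deriv
        (sum_truncatedField p N _)) ht h0
    simpa [hα0] using this
  have hle : ∀ i, ∀ t ∈ Icc (-(N : ℝ)) N, α t i ≤ N := fun i t ht =>
    (Finset.single_le_sum (fun i _ => (hpos i t ht).le) (Finset.mem_univ i)).trans_eq (hsum t ht)
  have hclamp : ∀ t ∈ Icc (-(N : ℝ)) N, clampCube (α t) = α t := by
    intro t ht
    ext i
    rw [clampCube, min_eq_right (hle i t ht), max_eq_right (by linarith [hpos i t ht])]
  refine ⟨fun j t => extendZero (α t) j, fun j t ht => ?_, fun j => ?_⟩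
  · by_cases hj : 1 ≤ j ∧ j ≤ N
    · obtain ⟨i, rfl⟩ : ∃ i : Fin N, j = (i : ℤ) + 1 := ⟨⟨(j - 1).toNat, by omega⟩, by
        simp; omega⟩
      have h1 := hi i t ht
      rw [hclamp t ht] at h1
      simp only [extendZero_succ _ i]
      rw [← extendZero_succ (α t) i]
      exact h1
    · simp only [extendZero, dif_neg hj, zero_mul]
      exact hasDerivWithinAt_const _ _ _
  · simp [extendZero, hα0]

/-! ### Bounds for the truncated lattices which are uniform in the size -/

namespace IsTruncatedSolution

variable {p N : ℕ} {u : ℤ → ℝ → ℝ}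

theorem zero_mem (N : ℕ) : (0 : ℝ) ∈ Icc (-(N : ℝ)) N := by constructor <;> simp

theorem eq_zero (hu : IsTruncatedSolution p N u) :
    ∀ j ≤ 0, ∀ t ∈ Icc (-(N : ℝ)) N, u j t = 0 := fun j hj =>
  hu.isSolution.eq_zero (zero_mem N) (by rw [hu.apply_zero, if_neg (by omega)])

theorem pos (hu : IsTruncatedSolution p N u) {j : ℤ} (hj : 1 ≤ j ∧ j ≤ N) :
    ∀ t ∈ Icc (-(N : ℝ)) N, 0 < u j t :=
  hu.isSolution.pos (zero_mem N) (by rw [hu.apply_zero, if_pos hj]; exact one_pos)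

theorem nonneg (hu : IsTruncatedSolution p N u) (j : ℤ) :
    ∀ t ∈ Icc (-(N : ℝ)) N, 0 ≤ u j t := by
  intro t ht
  by_cases hj : 1 ≤ j ∧ j ≤ N
  · exact (hu.pos hj t ht).le
  · exact (hu.isSolution.eq_zero (zero_mem N) (by rw [hu.apply_zero, if_neg hj]) t ht).ge

theorem apply_zero_le (hu : IsTruncatedSolution p N u) (j : ℤ) : u j 0 ≤ 1 := by
  rw [hu.apply_zero]; split_ifs <;> simp

theorem monotoneOn_prefixSum (hu : IsTruncatedSolution p N u) (j : ℤ) :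
    MonotoneOn (fun t => prefixSum (fun i => u i t) j) (Icc (-(N : ℝ)) N) :=
  _root_.monotoneOn_prefixSum hu.isSolution hu.eq_zero hu.nonneg j

theorem summable_two_pow (p k : ℕ) (T : ℝ) :
    Summable fun n : ℕ => (2 : ℝ) ^ ((p + 1) * (n + 1) + k) * T ^ n / (n.factorial : ℝ) :=
  IsAbsMonotoneSeq.summable_of_le_geometric (C := 2 ^ (p + 1 + k)) (A := 2 ^ (p + 1))
    (fun n => by positivity)
    (fun n => by rw [← pow_mul, ← pow_add]; exact le_of_eq (by congr 1; ring)) T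

theorem prefixSum_le_tsum (hp : 1 ≤ p) (hu : IsTruncatedSolution p N u) (hN : 1 ≤ N) {k : ℕ}
    (hk : k ≤ p) {T : ℝ} (hT : 0 ≤ T) (hTN : T ≤ N) :
    prefixSum (fun i => u i T) (k + 1) ≤
      ∑' n : ℕ, (2 : ℝ) ^ ((p + 1) * (n + 1) + k) * T ^ n / (n.factorial : ℝ) := by
  have hN0 : (0 : ℝ) < N := by positivity
  have hmem : T ∈ Icc (-(N : ℝ)) N := ⟨by linarith, hTN⟩
  obtain ⟨F, hF, hF0, hF'⟩ := exists_pos_hasDerivWithinAt_mul (zero_mem N).1 (zero_mem N).2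
    (hu.isSolution.continuousOn_prefixSum (k + 1))
  have hS : 0 ≤ prefixSum (fun i => u i T) (k + 1) :=
    prefixSum_nonneg (fun j => hu.nonneg j T hmem) _
  have h1 := hasSum_pathWeight_succ hp (by linarith) (zero_mem N) hu.isSolution hu.eq_zero
    hu.nonneg hu.apply_zero_le hk (fun t _ => (hF t).le) hF0 hF' hmem
  have hFT : 1 ≤ F T := by
    have := monotoneOn_Icc_of_hasDerivWithinAt hF' (fun t ht => mul_nonneg (hF t).le
      (prefixSum_nonneg (fun j => hu.nonneg j t ht) _)) (zero_mem N) hmem hT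
    rwa [hF0] at this
  calc prefixSum (fun i => u i T) (k + 1)
      ≤ F T * prefixSum (fun i => u i T) (k + 1) := le_mul_of_one_le_left hS hFT
    _ ≤ _ := by
      rw [← h1.tsum_eq]
      refine h1.summable.tsum_le_tsum (fun n => ?_) (summable_two_pow p k T)
      have := pathWeight_le (p := p) (fun j => hu.nonneg j 0 (zero_mem N)) hu.apply_zero_le
        ((p + 1) * (n + 1) + k) k
      gcongr

/-- On `[0, T + 1]` the derivative of `log (u m)` is at least `S (m+p) - 2 * B`. Since `u m 0 = 1`,
this gives `log (u m T) ≥ -2 * B * T`, while `log (u m (T+1)) ≤ B - 1`. As `S (m+p)` is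
nondecreasing, integration over `[T, T + 1]` bounds its value at `T`. -/
theorem prefixSum_add_le (hu : IsTruncatedSolution p N u) {m : ℤ} (hm1 : 1 ≤ m) (hmN : m ≤ N)
    {T B : ℝ} (hT : 0 ≤ T) (hTN : T + 1 ≤ N)
    (hB : prefixSum (fun i => u i (T + 1)) m ≤ B) :
    prefixSum (fun i => u i T) (m + p) ≤ B + 2 * B * (T + 1) := by
  have hsub : Icc 0 (T + 1) ⊆ Icc (-(N : ℝ)) N := Icc_subset_Icc (by simp) hTN
  have hpos : ∀ t ∈ Icc 0 (T + 1), 0 < u m t := fun t ht => hu.pos ⟨hm1, hmN⟩ t (hsub ht)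
  have hT1 : T + 1 ∈ Icc 0 (T + 1) := ⟨by linarith, le_rfl⟩
  have hv : ∀ t ∈ Icc 0 (T + 1), ∀ j ≤ 0, (fun i => u i t) j = 0 :=
    fun t ht j hj => hu.eq_zero j hj t (hsub ht)
  have hv0 : ∀ t ∈ Icc 0 (T + 1), ∀ j, 0 ≤ (fun i => u i t) j :=
    fun t ht j => hu.nonneg j t (hsub ht)
  have hder : ∀ t ∈ Icc 0 (T + 1), HasDerivWithinAt (fun t => Real.log (u m t) + 2 * B * t)
      (latticeRate p (fun i => u i t) m + 2 * B) (Icc 0 (T + 1)) t := by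
    intro t ht
    have h1 := ((hu.isSolution.hasDerivWithinAt m (hsub ht)).mono hsub).log (hpos t ht).ne'
    rw [mul_div_cancel_left₀ _ (hpos t ht).ne'] at h1
    exact (h1.add ((hasDerivAt_id t).const_mul (2 * B)).hasDerivWithinAt).congr_deriv (by simp)
  have hrate : ∀ t ∈ Icc 0 (T + 1),
      prefixSum (fun i => u i t) (m + p) ≤ latticeRate p (fun i => u i t) m + 2 * B := by
    intro t ht
    have h1 := hu.monotoneOn_prefixSum m (hsub ht) (hsub hT1) ht.2
    have h2 := prefixSum_mono (hv0 t ht) (show m - 1 ≤ m by omega)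
    have h3 := prefixSum_nonneg (hv0 t ht) (m - p - 1)
    rw [latticeRate_eq (hv t ht)]
    simp only at h1
    linarith
  set s := prefixSum (fun i => u i T) (m + p) with hs
  have hm := monotoneOn_Icc_of_hasDerivWithinAt hder fun t ht =>
    (prefixSum_nonneg (hv0 t ht) _).trans (hrate t ht)
  have e1 := hm (a := 0) (b := T) ⟨le_rfl, by linarith⟩ ⟨hT, by linarith⟩ hT
  have hsub' : Icc T (T + 1) ⊆ Icc 0 (T + 1) := Icc_subset_Icc_left hT
  have hm' := monotoneOn_Icc_of_hasDerivWithinAt (a := T) (b := T + 1) (fun t ht =>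
      ((hder t (hsub' ht)).mono hsub').sub ((hasDerivAt_id t).const_mul s).hasDerivWithinAt)
    (fun t ht => by
      have h1 := hu.monotoneOn_prefixSum (m + p) (hsub (hsub' ⟨le_rfl, by linarith⟩))
        (hsub (hsub' ht)) ht.1
      have h2 := hrate t (hsub' ht)
      simp only [mul_one, ← hs] at h1 ⊢
      linarith)
  have e2 := hm' (a := T) (b := T + 1) ⟨le_rfl, by linarith⟩ ⟨by linarith, le_rfl⟩ (by linarith)
  have e3 := Real.log_le_sub_one_of_pos (hpos _ hT1)
  have e4 := le_prefixSum (hv0 _ hT1) (hv _ hT1) (le_refl m)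
  beta_reduce at e1
  rw [hu.apply_zero m, if_pos ⟨hm1, hmN⟩] at e1
  simp at e1 e2 e4
  linarith

end IsTruncatedSolution

theorem exists_prefixSum_le {p : ℕ} (hp : 1 ≤ p) (j : ℕ) : ∀ T : ℝ, 0 ≤ T →
    ∃ B : ℝ, ∃ N₀ : ℕ, ∀ N ≥ N₀, ∀ u, IsTruncatedSolution p N u →
      prefixSum (fun i => u i T) j ≤ B := by
  induction j using Nat.strong_induction_on with
  | _ j ih =>
    intro T hT
    rcases Nat.eq_zero_or_pos j with rfl | hj
    · exact ⟨0, 0, fun N _ u _ => (prefixSum_of_nonpos _ (by simp)).le⟩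
    rcases le_or_gt j (p + 1) with hjp | hjp
    · obtain ⟨k, rfl⟩ := Nat.exists_eq_add_of_le' hj
      refine ⟨∑' n : ℕ, (2 : ℝ) ^ ((p + 1) * (n + 1) + k) * T ^ n / (n.factorial : ℝ), ⌈T⌉₊ + 1, fun N hN u hu => ?_⟩
      have h1 : T ≤ N := (Nat.le_ceil T).trans (by exact_mod_cast (by omega : ⌈T⌉₊ ≤ N))
      exact_mod_cast hu.prefixSum_le_tsum hp (by omega) (by omega : k ≤ p) hT h1
    -- Each passage to `p` further sites costs one unit of time, so the induction must cover all `T`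
    -- at once.
    · obtain ⟨B, N₀, h⟩ := ih (j - p) (by omega) (T + 1) (by linarith)
      refine ⟨B + 2 * B * (T + 1), max N₀ (max j (⌈T⌉₊ + 1)), fun N hN u hu => ?_⟩
      simp only [ge_iff_le, max_le_iff] at hN
      have h1 : T + 1 ≤ N := (add_le_add_left (Nat.le_ceil T) 1).trans
        (by exact_mod_cast (by omega : ⌈T⌉₊ + 1 ≤ N))
      have := hu.prefixSum_add_le (m := ((j - p : ℕ) : ℤ)) (by omega) (by omega) hT h1
        (h N hN.1 u hu)
      rwa [show ((j - p : ℕ) : ℤ) + p = j by omega] at this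

theorem exists_forall_mem_Icc_le {p : ℕ} (hp : 1 ≤ p) (j : ℤ) {T : ℝ} (hT : 0 ≤ T) :
    ∃ B : ℝ, ∃ N₀ : ℕ, T ≤ N₀ ∧ ∀ N ≥ N₀, ∀ u, IsTruncatedSolution p N u →
      ∀ i ≤ j, ∀ t ∈ Icc (-T) T, u i t ∈ Icc 0 B := by
  obtain ⟨B, N₀, h⟩ := exists_prefixSum_le hp j.toNat T hT
  refine ⟨B, max N₀ ⌈T⌉₊, (Nat.le_ceil T).trans (by exact_mod_cast le_max_right _ _),
    fun N hN u hu i hi t ht => ?_⟩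
  simp only [ge_iff_le, max_le_iff] at hN
  have hTN : T ≤ N := (Nat.le_ceil T).trans (by exact_mod_cast hN.2)
  have hmem : ∀ s ∈ Icc (-T) T, s ∈ Icc (-(N : ℝ)) N :=
    fun s hs => ⟨by linarith [hs.1], hs.2.trans hTN⟩
  refine ⟨hu.nonneg i t (hmem t ht), ?_⟩
  calc u i t ≤ prefixSum (fun i => u i t) (j.toNat : ℤ) :=
        le_prefixSum (v := fun i => u i t) (fun j => hu.nonneg j t (hmem t ht))
          (fun j hj => hu.eq_zero j hj t (hmem t ht)) (by omega)
    _ ≤ prefixSum (fun i => u i T) (j.toNat : ℤ) :=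
        hu.monotoneOn_prefixSum _ (hmem t ht) (hmem T ⟨by linarith, le_rfl⟩) ht.2
    _ ≤ B := h N hN.1 u hu

/-! ### Passage to the limit -/

theorem abs_sum_Icc_le {p : ℕ} {f : ℕ → ℝ} {C : ℝ} (h : ∀ k ∈ Finset.Icc 1 p, |f k| ≤ C) :
    |∑ k ∈ Finset.Icc 1 p, f k| ≤ p * C := by
  refine (Finset.abs_sum_le_sum_abs _ _).trans ((Finset.sum_le_card_nsmul _ _ _ h).trans_eq ?_)
  simp

theorem abs_latticeRate_sub_le {p : ℕ} {v w : ℤ → ℝ} {j : ℤ} {C : ℝ}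
    (h : ∀ i ≤ j + p, |v i - w i| ≤ C) :
    |latticeRate p v j - latticeRate p w j| ≤ 2 * p * C := by
  have h1 := abs_sum_Icc_le (p := p) (f := fun k => v (j + k) - w (j + k)) (C := C)
    (fun k hk => h _ (by rw [Finset.mem_Icc] at hk; omega))
  have h2 := abs_sum_Icc_le (p := p) (f := fun k => v (j - k) - w (j - k)) (C := C)
    (fun k hk => h _ (by rw [Finset.mem_Icc] at hk; omega))
  rw [Finset.sum_sub_distrib, abs_le] at h1 h2
  rw [latticeRate, latticeRate, abs_le]
  constructor <;> linarith [h1.1, h1.2, h2.1, h2.2]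

theorem abs_latticeRate_le {p : ℕ} {v : ℤ → ℝ} {j : ℤ} {C : ℝ}
    (h : ∀ i ≤ j + p, |v i| ≤ C) : |latticeRate p v j| ≤ 2 * p * C := by
  have := abs_latticeRate_sub_le (p := p) (v := v) (w := fun _ => 0) (j := j) (by simpa using h)
  simpa [latticeRate] using this

/-- A first-order expansion with quadratic error passes to pointwise limits, unlike a derivative.
The field is Lipschitz in time with constant `8 * p ^ 2 * B ^ 3`: varying `u j` and varying its rate
contribute `4 * p ^ 2 * B ^ 3` each. -/
theorem IsBogoyavlenskySolution.abs_sub_sub_le {p : ℕ} {a b : ℝ} {u : ℤ → ℝ → ℝ}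
    (hu : IsBogoyavlenskySolution p (Icc a b) u) {j : ℤ} {B : ℝ}
    (hB : ∀ i ≤ j + p + p, ∀ t ∈ Icc a b, |u i t| ≤ B) {s t : ℝ} (hs : s ∈ Icc a b)
    (ht : t ∈ Icc a b) :
    |u j s - u j t - (s - t) * (u j t * latticeRate p (fun i => u i t) j)| ≤
      (8 * p ^ 2 * B ^ 3) * |s - t| * |s - t| := by
  have hB0 : 0 ≤ B := (abs_nonneg _).trans (hB j (by omega) s hs)
  have hrate : ∀ i ≤ j + p, ∀ r ∈ Icc a b, |latticeRate p (fun i => u i r) i| ≤ 2 * p * B :=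
    fun i hi r hr => abs_latticeRate_le fun k hk => hB k (by omega) r hr
  have hlip : ∀ i ≤ j + p, ∀ r ∈ Icc a b, ∀ q ∈ Icc a b,
      |u i r - u i q| ≤ B * (2 * p * B) * |r - q| := by
    intro i hi r hr q hq
    refine (convex_Icc a b).norm_image_sub_le_of_norm_hasDerivWithin_le
      (fun x hx => hu.hasDerivWithinAt i hx) (fun x hx => ?_) hq hr
    rw [Real.norm_eq_abs, abs_mul]
    exact mul_le_mul (hB i (by omega) x hx) (hrate i hi x hx) (abs_nonneg _) hB0
  have hfield : ∀ r ∈ uIcc t s, |u j r * latticeRate p (fun i => u i r) j -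
      u j t * latticeRate p (fun i => u i t) j| ≤ (8 * p ^ 2 * B ^ 3) * |s - t| := by
    intro r hr
    have hr' : r ∈ Icc a b := uIcc_subset_Icc ht hs hr
    have h1 : |r - t| ≤ |s - t| := abs_sub_left_of_mem_uIcc hr
    have h2 : |latticeRate p (fun i => u i r) j - latticeRate p (fun i => u i t) j| ≤
        2 * p * (B * (2 * p * B) * |r - t|) :=
      abs_latticeRate_sub_le fun i hi => hlip i hi r hr' t ht
    have h3 := mul_le_mul (hlip j (by omega) r hr' t ht) (hrate j (by omega) r hr') (abs_nonneg _)
      (by positivity)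
    have h4 := mul_le_mul (hB j (by omega) t ht) h2 (abs_nonneg _) hB0
    rw [← abs_mul] at h3 h4
    calc _ = |(u j r - u j t) * latticeRate p (fun i => u i r) j +
          u j t * (latticeRate p (fun i => u i r) j - latticeRate p (fun i => u i t) j)| := by
          congr 1; ring
      _ ≤ _ := (abs_add_le _ _).trans (add_le_add h3 h4)
      _ = (8 * p ^ 2 * B ^ 3) * |r - t| := by ring
      _ ≤ _ := by gcongr
  have hsub : uIcc t s ⊆ Icc a b := uIcc_subset_Icc ht hs
  have := (convex_uIcc t s).norm_image_sub_le_of_norm_hasDerivWithin_le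
    (f := fun r => u j r - r * (u j t * latticeRate p (fun i => u i t) j))
    (fun r hr => ((hu.hasDerivWithinAt j (hsub hr)).mono hsub).sub
      ((hasDerivAt_id r).mul_const _).hasDerivWithinAt)
    (fun r hr => by simpa using hfield r hr) left_mem_uIcc right_mem_uIcc
  rw [Real.norm_eq_abs, Real.norm_eq_abs] at this
  refine le_of_eq_of_le ?_ this
  congr 1; ring

theorem hasDerivAt_of_abs_sub_sub_le {f : ℝ → ℝ} {c M t : ℝ}
    (h : ∀ s ∈ Icc (t - 1) (t + 1), |f s - f t - (s - t) * c| ≤ M * |s - t| * |s - t|) :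
    HasDerivAt f c t := by
  rw [hasDerivAt_iff_tendsto]
  have hlim : Tendsto (fun s => M * |s - t|) (𝓝 t) (𝓝 0) := by
    have : Continuous fun s => M * |s - t| := by fun_prop
    simpa using this.tendsto t
  refine squeeze_zero' (Eventually.of_forall fun s => by positivity) ?_ hlim
  filter_upwards [Icc_mem_nhds (show t - 1 < t by linarith) (show t < t + 1 by linarith)] with s hs
  rcases eq_or_ne s t with rfl | hne
  · simp
  · have : 0 < |s - t| := abs_pos.2 (sub_ne_zero.2 hne)
    rw [smul_eq_mul, Real.norm_eq_abs, Real.norm_eq_abs, inv_mul_le_iff₀ this]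
    linarith [h s hs]

theorem exists_isBogoyavlenskySolution {p : ℕ} (hp : 1 ≤ p) :
    ∃ u, IsBogoyavlenskySolution p univ u ∧ IsUnitStep u := by
  choose U hU using fun N : ℕ => exists_isTruncatedSolution p (N := N + 1) (by omega)
  -- A nonprincipal ultrafilter gives limits for all sites and all real times simultaneously, with
  -- no extraction of subsequences.
  have hev : ∀ N₀ : ℕ, ∀ᶠ N in (hyperfilter ℕ : Filter ℕ), N₀ ≤ N := fun N₀ =>
    Nat.hyperfilter_le_atTop (eventually_ge_atTop N₀)
  have hlim : ∀ j t, ∃ l, Tendsto (fun N => U N j t) (hyperfilter ℕ : Filter ℕ) (𝓝 l) := by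
    intro j t
    obtain ⟨B, N₀, -, h⟩ := exists_forall_mem_Icc_le hp j (abs_nonneg t)
    obtain ⟨l, -, hl⟩ := (isCompact_Icc (a := (0 : ℝ)) (b := B)).ultrafilter_le_nhds
      ((hyperfilter ℕ).map fun N => U N j t) (by
        rw [le_principal_iff, Ultrafilter.mem_coe, Ultrafilter.mem_map]
        filter_upwards [hev N₀] with N hN
        exact h (N + 1) (by omega) _ (hU N) j le_rfl t ⟨neg_abs_le t, le_abs_self t⟩)
    exact ⟨l, hl⟩
  choose u hu using hlim
  refine ⟨u, fun j t _ => HasDerivAt.hasDerivWithinAt ?_, fun j => ?_⟩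
  · obtain ⟨B, N₀, hTN, h⟩ := exists_forall_mem_Icc_le hp (j + p + p)
      (T := |t| + 1) (by positivity)
    refine hasDerivAt_of_abs_sub_sub_le (M := 8 * p ^ 2 * B ^ 3) fun s hs => ?_
    have htT : t ∈ Icc (-(|t| + 1)) (|t| + 1) :=
      ⟨by linarith [neg_abs_le t], by linarith [le_abs_self t]⟩
    have hsT : s ∈ Icc (-(|t| + 1)) (|t| + 1) :=
      ⟨by linarith [neg_abs_le t, hs.1], by linarith [le_abs_self t, hs.2]⟩
    have hrate : Tendsto (fun N => latticeRate p (fun i => U N i t) j)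
        (hyperfilter ℕ : Filter ℕ) (𝓝 (latticeRate p (fun i => u i t) j)) :=
      (tendsto_finsetSum _ fun _ _ => hu _ t).sub (tendsto_finsetSum _ fun _ _ => hu _ t)
    refine le_of_tendsto ((((hu j s).sub (hu j t)).sub
      (((hu j t).mul hrate).const_mul (s - t))).abs) ?_
    filter_upwards [hev N₀] with N hN
    have hcast : (N₀ : ℝ) ≤ (N + 1 : ℕ) := by exact_mod_cast (by omega : N₀ ≤ N + 1)
    have hsub : Icc (-(|t| + 1)) (|t| + 1) ⊆ Icc (-((N + 1 : ℕ) : ℝ)) (N + 1 : ℕ) :=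
      Icc_subset_Icc (by linarith) (by linarith)
    refine ((hU N).isSolution.mono hsub).abs_sub_sub_le (fun i hi r hr => ?_) hsT htT
    have := h (N + 1) (by omega) _ (hU N) i hi r hr
    rw [abs_of_nonneg this.1]
    exact this.2
  · refine tendsto_nhds_unique (hu j 0) (tendsto_const_nhds.congr' ?_)
    filter_upwards [hev j.toNat] with N hN
    rw [(hU N).apply_zero]
    by_cases hj : j ≤ 0
    · rw [if_pos hj, if_neg (by omega)]
    · rw [if_neg hj, if_pos (by omega)]

/-! ### Solutions with unit-step initial data -/

section

variable {p : ℕ} {a b : ℝ} {u w : ℤ → ℝ → ℝ}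

theorem IsUnitStep.apply_zero (h : IsUnitStep u) : (fun i => u i 0) = unitStep := funext h

theorem IsBogoyavlenskySolution.eq_zero_of_isUnitStep (hu : IsBogoyavlenskySolution p (Icc a b) u)
    (hu0 : IsUnitStep u) (h0 : (0 : ℝ) ∈ Icc a b) : ∀ j ≤ 0, ∀ t ∈ Icc a b, u j t = 0 :=
  fun j hj => hu.eq_zero h0 (by rw [hu0, if_pos hj])

theorem IsBogoyavlenskySolution.pos_of_isUnitStep (hu : IsBogoyavlenskySolution p (Icc a b) u)
    (hu0 : IsUnitStep u) (h0 : (0 : ℝ) ∈ Icc a b) {j : ℤ} (hj : 1 ≤ j) :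
    ∀ t ∈ Icc a b, 0 < u j t :=
  hu.pos h0 (by rw [hu0, if_neg (by omega)]; exact one_pos)

theorem IsBogoyavlenskySolution.nonneg_of_isUnitStep (hu : IsBogoyavlenskySolution p (Icc a b) u)
    (hu0 : IsUnitStep u) (h0 : (0 : ℝ) ∈ Icc a b) (j : ℤ) : ∀ t ∈ Icc a b, 0 ≤ u j t := by
  intro t ht
  rcases le_or_gt j 0 with hj | hj
  · exact (hu.eq_zero_of_isUnitStep hu0 h0 j hj t ht).ge
  · exact (hu.pos_of_isUnitStep hu0 h0 (by omega) t ht).le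

theorem hasSum_hypTerm (hp : 1 ≤ p) (hu : IsBogoyavlenskySolution p (Icc a b) u)
    (hu0 : IsUnitStep u) (h0 : (0 : ℝ) ∈ Icc a b) {k : ℕ} (hk : k ≤ p) {F : ℝ → ℝ}
    (hF : ∀ t ∈ Icc a b, 0 ≤ F t) (hF0 : F 0 = 1)
    (hF' : ∀ t ∈ Icc a b, HasDerivWithinAt F (F t * prefixSum (fun i => u i t) (k + 1))
      (Icc a b) t) {t : ℝ} (ht : t ∈ Icc a b) :
    HasSum (hypTerm (stepUpper p (k + 1)) (stepLower p (k + 1)) (stepScale p * t)) (F t) := by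
  have h := hasSum_pathWeight hp h0 hu (hu.eq_zero_of_isUnitStep hu0 h0)
    (hu.nonneg_of_isUnitStep hu0 h0) (fun j => by rw [hu0]; split_ifs <;> simp) hk hF hF0 hF' ht
  rw [hu0.apply_zero] at h
  exact h.congr_fun fun n => hypTerm_step hp hk t n

/-- The first `p + 1` prefix sums are logarithmic derivatives of the hypergeometric functions. -/
theorem prefixSum_eq_of_le (hp : 1 ≤ p) (hab : a < b) (h0 : (0 : ℝ) ∈ Icc a b)
    (hu : IsBogoyavlenskySolution p (Icc a b) u) (hu0 : IsUnitStep u)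
    (hw : IsBogoyavlenskySolution p (Icc a b) w) (hw0 : IsUnitStep w) {k : ℕ} (hk : k ≤ p)
    {t : ℝ} (ht : t ∈ Icc a b) :
    prefixSum (fun i => u i t) (k + 1) = prefixSum (fun i => w i t) (k + 1) := by
  obtain ⟨F, hF, hF0, hF'⟩ := exists_pos_hasDerivWithinAt_mul h0.1 h0.2
    (hu.continuousOn_prefixSum (k + 1))
  obtain ⟨G, hG, hG0, hG'⟩ := exists_pos_hasDerivWithinAt_mul h0.1 h0.2
    (hw.continuousOn_prefixSum (k + 1))
  have hFG : EqOn F G (Icc a b) := fun s hs =>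
    (hasSum_hypTerm hp hu hu0 h0 hk (fun t _ => (hF t).le) hF0 hF' hs).unique
      (hasSum_hypTerm hp hw hw0 h0 hk (fun t _ => (hG t).le) hG0 hG' hs)
  have h1 := (uniqueDiffOn_Icc hab t ht).eq_deriv _ (hF' t ht) ((hG' t ht).congr hFG (hFG ht))
  rw [hFG ht] at h1
  exact mul_left_cancel₀ (hG t).ne' h1

theorem prefixSum_eq (hp : 1 ≤ p) (hab : a < b) (h0 : (0 : ℝ) ∈ Icc a b)
    (hu : IsBogoyavlenskySolution p (Icc a b) u) (hu0 : IsUnitStep u)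
    (hw : IsBogoyavlenskySolution p (Icc a b) w) (hw0 : IsUnitStep w) (n : ℕ) :
    ∀ j : ℤ, j ≤ n → ∀ t ∈ Icc a b,
      prefixSum (fun i => u i t) j = prefixSum (fun i => w i t) j := by
  have hzu := hu.eq_zero_of_isUnitStep hu0 h0
  have hzw := hw.eq_zero_of_isUnitStep hw0 h0
  induction n with
  | zero =>
    intro j hj t _
    rw [prefixSum_of_nonpos _ (by simpa using hj), prefixSum_of_nonpos _ (by simpa using hj)]
  | succ n ih =>
    intro j hj t ht
    rcases Int.lt_or_eq_of_le hj with hj' | rfl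
    · exact ih j (by push_cast at hj'; omega) t ht
    rcases le_or_gt n p with hn | hn
    · exact_mod_cast prefixSum_eq_of_le hp hab h0 hu hu0 hw hw0 hn ht
    -- Here `m ≤ n`, so `u m` is already determined on the whole interval, and `m ≥ 1`, so it may be
    -- cancelled in its own equation. The rate left over contains `S (m+p) = S (n+1)` as the only
    -- unknown.
    obtain ⟨m, hm⟩ : ∃ m : ℤ, m + p = (n + 1 : ℕ) := ⟨(n + 1 : ℕ) - p, by ring⟩
    push_cast at hm
    have heq : EqOn (u m) (w m) (Icc a b) := by
      intro s hs
      have h1 := prefixSum_eq_add (v := fun i => u i s) (fun j hj => hzu j hj s hs) m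
      have h2 := prefixSum_eq_add (v := fun i => w i s) (fun j hj => hzw j hj s hs) m
      have h3 := ih m (by omega) s hs
      have h4 := ih (m - 1) (by omega) s hs
      linarith
    have hd := (uniqueDiffOn_Icc hab t ht).eq_deriv _ (hu.hasDerivWithinAt m ht)
      ((hw.hasDerivWithinAt m ht).congr heq (heq ht))
    rw [heq ht] at hd
    have hd' := mul_left_cancel₀ (hw.pos_of_isUnitStep hw0 h0 (by omega) t ht).ne' hd
    rw [latticeRate_eq (fun j hj => hzu j hj t ht), latticeRate_eq (fun j hj => hzw j hj t ht),
      ih m (by omega) t ht, ih (m - 1) (by omega) t ht, ih (m - p - 1) (by omega) t ht] at hd'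
    push_cast
    rw [← hm]
    linarith

theorem IsBogoyavlenskySolution.eqOn_Icc (hp : 1 ≤ p) (hab : a < b) (h0 : (0 : ℝ) ∈ Icc a b)
    (hu : IsBogoyavlenskySolution p (Icc a b) u) (hu0 : IsUnitStep u)
    (hw : IsBogoyavlenskySolution p (Icc a b) w) (hw0 : IsUnitStep w) (j : ℤ) :
    EqOn (u j) (w j) (Icc a b) := by
  intro t ht
  have h1 := prefixSum_eq_add (v := fun i => u i t)
    (fun j hj => hu.eq_zero_of_isUnitStep hu0 h0 j hj t ht) j
  have h2 := prefixSum_eq_add (v := fun i => w i t)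
    (fun j hj => hw.eq_zero_of_isUnitStep hw0 h0 j hj t ht) j
  have h3 := prefixSum_eq hp hab h0 hu hu0 hw hw0 j.toNat j (by omega) t ht
  have h4 := prefixSum_eq hp hab h0 hu hu0 hw hw0 j.toNat (j - 1) (by omega) t ht
  linarith

theorem IsBogoyavlenskySolution.eqOn (hp : 1 ≤ p) {I : Set ℝ} (hI : I.OrdConnected)
    (h0 : (0 : ℝ) ∈ I) (hu : IsBogoyavlenskySolution p I u) (hu0 : IsUnitStep u)
    (hw : IsBogoyavlenskySolution p I w) (hw0 : IsUnitStep w) (j : ℤ) : EqOn (u j) (w j) I := by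
  intro t ht
  rcases lt_trichotomy t 0 with h | rfl | h
  · have hs := hI.out ht h0
    exact (hu.mono hs).eqOn_Icc hp h ⟨h.le, le_rfl⟩ hu0 (hw.mono hs) hw0 j ⟨le_rfl, h.le⟩
  · rw [hu0, hw0]
  · have hs := hI.out h0 ht
    exact (hu.mono hs).eqOn_Icc hp h ⟨le_rfl, h.le⟩ hu0 (hw.mono hs) hw0 j ⟨h.le, le_rfl⟩

end

/-! ### The tau functions of a global solution -/

/-- The function with value `1` at `0` and logarithmic derivative `u_1 + ⋯ + u_j`. -/
def tauFunction (u : ℤ → ℝ → ℝ) (j : ℤ) (t : ℝ) : ℝ :=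
  Real.exp (∫ s in (0 : ℝ)..t, prefixSum (fun i => u i s) j)

section

variable {p : ℕ} {u : ℤ → ℝ → ℝ}

theorem tauFunction_pos (u : ℤ → ℝ → ℝ) (j : ℤ) (t : ℝ) : 0 < tauFunction u j t := Real.exp_pos _

theorem tauFunction_zero_right (u : ℤ → ℝ → ℝ) (j : ℤ) : tauFunction u j 0 = 1 := by
  simp [tauFunction]

theorem tauFunction_of_nonpos (u : ℤ → ℝ → ℝ) {j : ℤ} (hj : j ≤ 0) (t : ℝ) :
    tauFunction u j t = 1 := by
  simp [tauFunction, prefixSum_of_nonpos _ hj]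

theorem hasDerivAt_tauFunction (hu : IsBogoyavlenskySolution p univ u) (j : ℤ) (t : ℝ) :
    HasDerivAt (tauFunction u j) (tauFunction u j t * prefixSum (fun i => u i t) j) t := by
  have hcont : Continuous fun t => prefixSum (fun i => u i t) j :=
    continuousOn_univ.1 (hu.continuousOn_prefixSum j)
  exact (intervalIntegral.integral_hasDerivAt_right (hcont.intervalIntegrable _ _)
    (hcont.stronglyMeasurableAtFilter _ _) hcont.continuousAt).exp

theorem IsBogoyavlenskySolution.eq_zero_of_nonpos (hu : IsBogoyavlenskySolution p univ u) (hu0 : IsUnitStep u) :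
    ∀ j ≤ 0, ∀ t, u j t = 0 := fun j hj t =>
  (hu.mono (subset_univ (Icc (-|t|) |t|))).eq_zero_of_isUnitStep hu0 (by simp) j hj t
    ⟨neg_abs_le t, le_abs_self t⟩

theorem hasSum_hypTerm_tauFunction (hp : 1 ≤ p) (hu : IsBogoyavlenskySolution p univ u)
    (hu0 : IsUnitStep u) {k : ℕ} (hk : k ≤ p) (t : ℝ) :
    HasSum (hypTerm (stepUpper p (k + 1)) (stepLower p (k + 1)) (stepScale p * t))
      (tauFunction u (k + 1) t) :=
  hasSum_hypTerm hp (hu.mono (subset_univ (Icc (-|t|) |t|))) hu0 (by simp) hk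
    (fun s _ => (tauFunction_pos u _ s).le) (tauFunction_zero_right u _)
    (fun s _ => (hasDerivAt_tauFunction hu _ s).hasDerivWithinAt)
    ⟨neg_abs_le t, le_abs_self t⟩

/-- By `latticeRate_eq` both sides have the same logarithmic derivative, so their quotient is
constant; at `0` it equals `1` because `u j 0 = 1` for `j ≥ 1`. -/
theorem mul_tauFunction_eq (hu : IsBogoyavlenskySolution p univ u) (hu0 : IsUnitStep u) {j : ℤ}
    (hj : 1 ≤ j) (t : ℝ) :
    u j t * (tauFunction u (j - 1) t * tauFunction u j t) =
      tauFunction u (j - p - 1) t * tauFunction u (j + p) t := by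
  have hz := hu.eq_zero_of_nonpos hu0
  have hne : ∀ i s, tauFunction u i s ≠ 0 := fun i s => (tauFunction_pos u i s).ne'
  have hder : ∀ s, HasDerivAt (fun s => u j s * (tauFunction u (j - 1) s * tauFunction u j s) /
      (tauFunction u (j - p - 1) s * tauFunction u (j + p) s)) 0 s := by
    intro s
    have h1 : HasDerivAt (u j) _ s :=
      (hu.hasDerivWithinAt j (mem_univ s)).hasDerivAt univ_mem
    refine ((h1.mul ((hasDerivAt_tauFunction hu (j - 1) s).mul
      (hasDerivAt_tauFunction hu j s))).fun_div ((hasDerivAt_tauFunction hu (j - p - 1) s).mul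
      (hasDerivAt_tauFunction hu (j + p) s)) (mul_ne_zero (hne _ _) (hne _ _))).congr_deriv ?_
    rw [latticeRate_eq (fun i hi => hz i hi s), div_eq_zero_iff]
    left
    simp only [Pi.mul_apply]
    ring
  have hc := is_const_of_deriv_eq_zero (fun s => (hder s).differentiableAt)
    (fun s => (hder s).deriv) t 0
  simp only [tauFunction_zero_right, mul_one, div_one] at hc
  rw [hu0 j, if_neg (by omega), div_eq_one_iff_eq (mul_ne_zero (hne _ _) (hne _ _))] at hc
  exact hc

end

end

theorem proposition1 (p : ℕ) (hp : 1 ≤ p) :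
    -- the hypergeometric series converge for every real argument
    (∀ j : ℕ, 1 ≤ j → j ≤ p + 1 → ∀ z : ℝ,
      Summable (hypTerm (stepUpper p j) (stepLower p j) z)) ∧
    ∃ u : ℤ → ℝ → ℝ,
      -- `u` solves the Cauchy problem on the whole line
      IsBogoyavlenskySolution p Set.univ u ∧ IsUnitStep u ∧
      -- it is the only solution, on every interval containing `0`
      (∀ (I : Set ℝ) (w : ℤ → ℝ → ℝ), I.OrdConnected → (0 : ℝ) ∈ I →
        IsBogoyavlenskySolution p I w → IsUnitStep w →
        ∀ j : ℤ, Set.EqOn (w j) (u j) I) ∧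
      -- it is given by the formulae
      (∀ j : ℤ, j ≤ 0 → ∀ t : ℝ, u j t = 0) ∧
      ∃ f : ℤ → ℝ → ℝ,
        (∀ j : ℕ, 1 ≤ j → j ≤ p + 1 → f (j : ℤ) = stepTau p j) ∧
        (∀ j : ℤ, j ≤ 0 → ∀ t : ℝ, f j t = 1) ∧
        (∀ j : ℤ, Differentiable ℝ (f j)) ∧
        (∀ (j : ℤ) (t : ℝ), f j t ≠ 0) ∧
        (∀ j : ℤ, 1 ≤ j → ∀ t : ℝ,
          f (j - 1) t * deriv (f j) t - deriv (f (j - 1)) t * f j t =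
            f (j - (p : ℤ) - 1) t * f (j + (p : ℤ)) t) ∧
        (∀ t : ℝ, u 1 t = deriv (f 1) t / f 1 t) ∧
        (∀ j : ℤ, 2 ≤ j → ∀ t : ℝ,
          u j t = deriv (f j) t / f j t - deriv (f (j - 1)) t / f (j - 1) t) := by
  obtain ⟨u, hu, hu0⟩ := exists_isBogoyavlenskySolution hp
  have hz := hu.eq_zero_of_nonpos hu0
  have hdiv : ∀ j t, deriv (tauFunction u j) t / tauFunction u j t =
      prefixSum (fun i => u i t) j := fun j t => by
    rw [(hasDerivAt_tauFunction hu j t).deriv, mul_div_cancel_left₀ _ (tauFunction_pos u j t).ne']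
  have hadd : ∀ j t, prefixSum (fun i => u i t) j = prefixSum (fun i => u i t) (j - 1) + u j t :=
    fun j t => prefixSum_eq_add (fun i hi => hz i hi t) j
  refine ⟨fun j hj hjp z => ?_, u, hu, hu0, fun I w hI h0 hw hw0 j => ?_, hz, tauFunction u,
    fun j hj hjp => ?_, fun j hj t => tauFunction_of_nonpos u hj t,
    fun j t => (hasDerivAt_tauFunction hu j t).differentiableAt,
    fun j t => (tauFunction_pos u j t).ne', fun j hj t => ?_, fun t => ?_, fun j _ t => ?_⟩
  · obtain ⟨k, rfl⟩ := Nat.exists_eq_add_of_le' hj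
    -- Convergence is a by-product of global existence: every real `z` is the scaled argument of
    -- some time.
    have h := (hasSum_hypTerm_tauFunction hp hu hu0 (k := k) (by omega) (z / stepScale p)).summable
    rwa [mul_div_cancel₀ _ (stepScale_ne_zero hp)] at h
  · exact hw.eqOn hp hI h0 hw0 (hu.mono (Set.subset_univ I)) hu0 j
  · obtain ⟨k, rfl⟩ := Nat.exists_eq_add_of_le' hj
    ext t
    exact_mod_cast (hasSum_hypTerm_tauFunction hp hu hu0 (k := k) (by omega) t).tsum_eq.symm
  · rw [← mul_tauFunction_eq hu hu0 hj, (hasDerivAt_tauFunction hu j t).deriv,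
      (hasDerivAt_tauFunction hu (j - 1) t).deriv, hadd j t]
    ring
  · rw [hdiv, hadd, prefixSum_of_nonpos _ (by norm_num), zero_add]
  · rw [hdiv, hdiv, hadd j]
    ring
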